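/- Let $V_0,V_1,V_2,\dots$ be i.i.d. nonnegative random variables with distribution function $F$, $\bar F=1-F$ and $\mathbb E[V_0]>0$, such that $\bar F$ is regularly varying of index $-\nu$ with $\nu\in(1,2)$, i.e. $\bar F(cx)/\bar F(x)\to c^{-\nu}$ as $x\to\infty$ for every $c>0$. Put $\lambda=1/\mathbb E[V_0]$. For each $n$ consider a single-server FIFO queue, empty at time $0$, whose arrivals form a Poisson process of rate $\lambda^{(n)}>0$ independent of $(V_i)$ and whose $i$-th arriving job has service time $V_i$. Assume that $\lambda^{(n)}$ is nondecreasing in $n$ with $\lambda^{(n)}\to\lambda$, and that, with $\rho^{(n)}=\lambda^{(n)}\mathbb E[V_0]$, $$\frac{1-\rho^{(n)}}{n\bar F(n)}\longrightarrow\gamma\in[0,\infty)\qquad(n\to\infty).$$ Each job that finds the system empty on arrival starts a new busy period. Let $M_k^{(n)}$ be the largest service time among the jobs of the $k$-th busy period of the $n$-th queue and $\bar m_k^{(n)}(x)=1-\mathbb P(M_k^{(n)}\le x)$ (its law does not depend on $k$, and one writes $\bar m^{(n)}$). Let $T_\nu$ be a Pareto$(\nu)$ random variable, $\mathbb P(T_\nu>t)=t^{-\nu}$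 for $t\ge1$. **Theorem.** For every $y>0$ the equation $$\left(\frac{-1}{\Gamma(1-\nu)}\right)\mathbb E\!\left[e^{-\lambda\kappa T_\nu}\right]-\kappa\gamma y^{\nu-1}\left(\frac{-1}{\Gamma(1-\nu)}\right)=(\lambda\kappa)^\nu$$ has a unique solution $\kappa=\kappa(y)>0$. For every $k$ and every $y>0$, $$\lim_{n\to\infty}n\,\bar m_k^{(n)}(ny)=\frac{\kappa(y)}{y}.$$ The function $\kappa$ is constant on $(0,\infty)$ if $\gamma=0$, and regularly varying at infinity of index $1-\nu$ (i.e. $\kappa(cy)/\kappa(y)\to c^{1-\nu}$ as $y\to\infty$ for every $c>0$) if $\gamma>0$. Moreover $\kappa$ is continuous on $(0,\infty)$ and bounded, with $\kappa(y)\le\frac1\lambda\left(\frac{-1}{\Gamma(1-\nu)}\right)^{1/\nu}$ for all $y>0$. -/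

import Mathlib

open MeasureTheory ProbabilityTheory Filter Topology

noncomputable section

namespace TandemQueue

/-- Distribution function `x ↦ P(X ≤ x)` of a real random variable. -/
def distFun {Ω : Type*} [MeasurableSpace Ω] (μ : Measure Ω) (X : Ω → ℝ) (x : ℝ) : ℝ :=
  μ.real {ω | X ω ≤ x}

/-- Tail `x ↦ 1 - P(X ≤ x)` of the distribution function. -/
def tail {Ω : Type*} [MeasurableSpace Ω] (μ : Measure Ω) (X : Ω → ℝ) (x : ℝ) : ℝ :=
  1 - distFun μ X x

/-- Regular variation (at infinity) with index `α`. -/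
def RegularlyVarying (f : ℝ → ℝ) (α : ℝ) : Prop :=
  ∀ c : ℝ, 0 < c → Tendsto (fun x => f (c * x) / f x) atTop (𝓝 (c ^ α))

/-- Work present in a single-server FIFO queue, empty at time zero, just before the arrival of
job `i` (Lindley recursion). Jobs are numbered `0, 1, 2, …`; job `i` brings the amount of work
`v i`; `τ 0` is the arrival time of job `0` and `τ (i + 1)` is the time between the arrivals of
jobs `i` and `i + 1`. -/
def workAtArrival (v τ : ℕ → ℝ) : ℕ → ℝ
  | 0 => 0
  | i + 1 => max (workAtArrival v τ i + v i - τ (i + 1)) 0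

/-- Index (from `0`) of the busy period to which job `i` belongs: every job that finds the
system empty opens a new busy period, so this is the number of jobs among `1, …, i` that find
the system empty. -/
def busyIndex (v τ : ℕ → ℝ) (i : ℕ) : ℕ :=
  ((Finset.Icc 1 i).filter (fun j => workAtArrival v τ j = 0)).card

/-- Service requirement of the largest job of the `k`-th busy period. -/
def largestJob (v τ : ℕ → ℝ) (k : ℕ) : ℝ :=
  sSup (v '' {i | busyIndex v τ i = k})

/-- The equation in the unknown `κ`, with parameters `ν, lam, γ, y`:
`(-1/Γ(1-ν)) E[exp(-lam κ T)] - κ γ y^(ν-1) (-1/Γ(1-ν)) = (lam κ)^ν`, where `T` has the Pareto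
law with `P(T > t) = t^(-ν)`, `t ≥ 1`. -/
def KappaEquation (ν lam γ y κ : ℝ) : Prop :=
  (-1 / Real.Gamma (1 - ν)) * (∫ t, Real.exp (-(lam * κ * t)) ∂(paretoMeasure 1 ν))
      - κ * γ * y ^ (ν - 1) * (-1 / Real.Gamma (1 - ν))
    = (lam * κ) ^ ν

end TandemQueue

end

noncomputable section

namespace TandemQueue

/-! ### Busy periods along a sample path -/

section Deterministic

variable (v t : ℕ → ℝ)

/-! The proof has an exact part, valid for each queue, and an asymptotic part.

Exact part. Fix `x`, let `r` be the arrival rate, and follow the work `W` found by successive jobs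
of one busy period, killed when a service time exceeds `x`. Interarrival times are exponential, so
the overshoot of `W` below zero is again exponential with rate `r`, whatever the current level.
Hence `exp(-θ W)`, with an exit from the period weighted by `r/(r-θ)`, is multiplied in mean by the
constant `r/(r-θ) · E[exp(-θ V); V ≤ x]` at each step (`workLaplace_step`). If `q` solves
`E[exp(-r(1-q)V); V ≤ x] = q`, then `θ = r(1-q)` makes this constant 1 and the weight `1/q`. Mass is
then conserved. Since every busy period occurs almost surely when the load is at most 1
(`tsum_starting`) and the residual mass vanishes (`tendsto_workLaplace`), `P(M ≤ x) = q`
(`measure_largestJob_le`).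

Asymptotic part. With `u = r(1-q)x` the equation for `q` becomes `fixedPointGap P r x u = 0`. For `x
= ny`, after division by the service tail at `x`, its three terms converge: the second-order Laplace
remainder to `-Γ(1-ν) u^ν`, the slack `1-ρ` to `(u/λ) γ y^(ν-1)`, and the part above `x` to the
Pareto transform at `u` (`tendsto_fixedPointGap`). The limit is `kappaGap` at `u/λ`. Both gaps are
monotone in `u`, so pointwise convergence forces the roots to converge to `λκ(y)`
(`tendsto_fixedPoint`), and division by `r y` gives the claim. The properties of `κ` follow from the
strict monotonicity of `kappaGap`. -/

lemma workAtArrival_nonneg (j : ℕ) : 0 ≤ workAtArrival v t j := by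
  cases j with
  | zero => exact le_rfl
  | succ j => exact le_max_right _ _

lemma busyIndex_zero : busyIndex v t 0 = 0 := by simp [busyIndex]

lemma busyIndex_succ (j : ℕ) :
    busyIndex v t (j + 1) = busyIndex v t j + if workAtArrival v t (j + 1) = 0 then 1 else 0 := by
  have h : Finset.Icc 1 (j + 1) = insert (j + 1) (Finset.Icc 1 j) := by ext; simp; omega
  rw [busyIndex, busyIndex, h, Finset.filter_insert]
  split_ifs
  · rw [Finset.card_insert_of_notMem (by simp)]
  · rfl

lemma busyIndex_mono : Monotone (busyIndex v t) :=
  monotone_nat_of_le_succ fun j => by rw [busyIndex_succ]; omega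

lemma busyIndex_lt_of_start {i j : ℕ} (hij : i < j) (hj : workAtArrival v t j = 0) :
    busyIndex v t i < busyIndex v t j := by
  obtain ⟨m, rfl⟩ : ∃ m, j = m + 1 := ⟨j - 1, by omega⟩
  have := busyIndex_mono v t (show i ≤ m by omega)
  rw [busyIndex_succ, if_pos hj]
  omega

/-- Once the `k`-th busy period ends with job `j`, its largest job is at most `x` exactly when all
its jobs are. -/
lemma largestJob_le_iff {j k : ℕ} (hk : busyIndex v t j = k)
    (h0 : workAtArrival v t (j + 1) = 0) (x : ℝ) :
    largestJob v t k ≤ x ↔ ∀ i ≤ j, busyIndex v t i = k → v i ≤ x := by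
  have hsub : ∀ i, busyIndex v t i = k → i ≤ j := by
    intro i hi
    by_contra! h
    have h1 := busyIndex_mono v t (show j + 1 ≤ i by omega)
    have h2 := busyIndex_lt_of_start v t (show j < j + 1 by omega) h0
    omega
  have hfin : {i | busyIndex v t i = k}.Finite :=
    (Set.finite_Iic j).subset fun i hi => hsub i hi
  -- The real `sSup` is 0 on unbounded or empty sets, so the finiteness of the period is essential
  -- here.
  rw [largestJob, csSup_le_iff (hfin.image v).bddAbove ⟨_, Set.mem_image_of_mem v hk⟩]
  simp only [Set.forall_mem_image, Set.mem_ofPred_eq]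
  exact ⟨fun h i _ hi => h hi, fun h i hi => h i (hsub i hi) hi⟩

end Deterministic

/-! ### The queue as a Markov chain -/

section Chain

variable {Ω : Type*}

/-- Work found by job `j`, as a random variable. -/
def work (V τ : ℕ → Ω → ℝ) (j : ℕ) (ω : Ω) : ℝ :=
  workAtArrival (fun i => V i ω) (fun i => τ i ω) j

/-- Index of the busy period of job `j`, as a random variable. -/
def period (V τ : ℕ → Ω → ℝ) (j : ℕ) (ω : Ω) : ℕ :=
  busyIndex (fun i => V i ω) (fun i => τ i ω) j

/-- Everything that happens strictly before the service time of job `j` is revealed. -/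
abbrev past (V τ : ℕ → Ω → ℝ) (j : ℕ) : MeasurableSpace Ω :=
  (⨆ i ∈ Set.Iio j, MeasurableSpace.comap (V i) inferInstance) ⊔
    ⨆ i ∈ Set.Iic j, MeasurableSpace.comap (τ i) inferInstance

/-- Job `j` belongs to busy period `k`, whose jobs before `j` have service times in `S`. -/
def ongoing (V τ : ℕ → Ω → ℝ) (k : ℕ) (S : Set ℝ) (j : ℕ) : Set Ω :=
  {ω | period V τ j ω = k ∧ ∀ i < j, period V τ i ω = k → V i ω ∈ S}

/-- Job `j` is the last one of busy period `k`, whose jobs all have service times in `S`. -/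
def ending (V τ : ℕ → Ω → ℝ) (k : ℕ) (S : Set ℝ) (j : ℕ) : Set Ω :=
  ongoing V τ k S j ∩ {ω | V j ω ∈ S ∧ work V τ (j + 1) ω = 0}

/-- Job `j` is the first one of busy period `k`. -/
def starting (V τ : ℕ → Ω → ℝ) (k j : ℕ) : Set Ω :=
  {ω | period V τ j ω = k ∧ work V τ j ω = 0}

variable {V τ : ℕ → Ω → ℝ}

lemma work_nonneg (j : ℕ) (ω : Ω) : 0 ≤ work V τ j ω := workAtArrival_nonneg _ _ _

lemma work_succ (j : ℕ) (ω : Ω) :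
    work V τ (j + 1) ω = max (work V τ j ω + V j ω - τ (j + 1) ω) 0 := rfl

lemma work_succ_eq_zero_iff (j : ℕ) (ω : Ω) :
    work V τ (j + 1) ω = 0 ↔ ¬ τ (j + 1) ω < work V τ j ω + V j ω := by
  rw [work_succ, max_eq_right_iff]
  constructor <;> intro h <;> linarith

lemma period_succ (j : ℕ) (ω : Ω) :
    period V τ (j + 1) ω = period V τ j ω + if work V τ (j + 1) ω = 0 then 1 else 0 :=
  busyIndex_succ _ _ _

lemma ongoing_zero (k : ℕ) (S : Set ℝ) : ongoing V τ k S 0 = starting V τ k 0 := by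
  ext ω
  simp [ongoing, starting, work, workAtArrival]

lemma starting_zero_zero : starting V τ 0 0 = Set.univ := by
  ext ω
  simp [starting, work, period, workAtArrival, busyIndex_zero]

lemma starting_succ_zero (k : ℕ) : starting V τ (k + 1) 0 = ∅ := by
  ext ω
  simp [starting, period, busyIndex_zero]

lemma starting_zero_succ (j : ℕ) : starting V τ 0 (j + 1) = ∅ := by
  ext ω
  simp only [starting, Set.mem_ofPred_eq, Set.mem_empty_iff_false, iff_false, not_and]
  intro h h0
  rw [period_succ, if_pos h0] at h
  omega

/-- This link between consecutive periods drives the induction on `k`: the next one opens with the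
job that follows the last job of this one. -/
lemma starting_succ_succ (k j : ℕ) :
    starting V τ (k + 1) (j + 1) = ending V τ k Set.univ j := by
  ext ω
  simp only [starting, ending, ongoing, Set.mem_ofPred_eq, Set.mem_inter_iff, Set.mem_univ,
    implies_true, and_true, true_and, period_succ]
  constructor
  · rintro ⟨h, h0⟩
    rw [if_pos h0] at h
    exact ⟨by omega, h0⟩
  · rintro ⟨h, h0⟩
    rw [if_pos h0, h]
    exact ⟨rfl, h0⟩

lemma ongoing_succ (k : ℕ) (S : Set ℝ) (j : ℕ) :
    ongoing V τ k S (j + 1) =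
      (ongoing V τ k S j ∩ {ω | V j ω ∈ S ∧ work V τ (j + 1) ω ≠ 0}) ∪
        starting V τ k (j + 1) := by
  ext ω
  simp only [ongoing, starting, Set.mem_ofPred_eq, Set.mem_inter_iff, Set.mem_union]
  by_cases h0 : work V τ (j + 1) ω = 0
  · simp only [h0, ne_eq, not_true_eq_false, and_false, false_or, and_true]
    -- When job `j + 1` opens period `k`, no earlier job has index `k`, so the constraint on service
    -- times is vacuous.
    refine ⟨fun h => h.1, fun h => ⟨h, fun i hi hik => ?_⟩⟩
    have := busyIndex_lt_of_start (fun i => V i ω) (fun i => τ i ω) hi h0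
    change period V τ i ω < period V τ (j + 1) ω at this
    omega
  · have hp : period V τ (j + 1) ω = period V τ j ω := by rw [period_succ, if_neg h0, add_zero]
    simp only [hp, h0, ne_eq, not_false_eq_true, and_true, and_false, or_false]
    constructor
    · rintro ⟨h, h'⟩
      exact ⟨⟨h, fun i hi => h' i (by omega)⟩, h' j (by omega) h⟩
    · rintro ⟨⟨h, h'⟩, hj⟩
      refine ⟨h, fun i hi hik => ?_⟩
      rcases Nat.lt_succ_iff_lt_or_eq.1 hi with hi | rfl
      · exact h' i hi hik
      · exact hj

lemma disjoint_starting (k : ℕ) : Pairwise fun i j =>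
    Disjoint (starting V τ k i) (starting V τ k j) := by
  have key : ∀ i j, i < j → Disjoint (starting V τ k i) (starting V τ k j) := by
    intro i j hij
    refine Set.disjoint_left.2 fun ω hi hj => ?_
    have := busyIndex_lt_of_start (fun i => V i ω) (fun i => τ i ω) hij hj.2
    exact absurd (hi.1.trans hj.1.symm) this.ne
  intro i j hij
  rcases lt_or_gt_of_ne hij with h | h
  · exact key i j h
  · exact (key j i h).symm

lemma ending_subset (k : ℕ) (S : Set ℝ) (j : ℕ) :
    ending V τ k S j ⊆ ending V τ k Set.univ j := by
  rintro ω ⟨⟨h, -⟩, -, h0⟩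
  exact ⟨⟨h, fun _ _ _ => trivial⟩, trivial, h0⟩

lemma disjoint_ending (k : ℕ) (S : Set ℝ) : Pairwise fun i j =>
    Disjoint (ending V τ k S i) (ending V τ k S j) := by
  intro i j hij
  have := disjoint_starting (V := V) (τ := τ) (k + 1) (show i + 1 ≠ j + 1 by omega)
  simp only [starting_succ_succ] at this
  exact this.mono (ending_subset k S i) (ending_subset k S j)

/-- If the `k`-th busy period ends, its largest job is at most `x` exactly when it ends with all
service times at most `x`. -/
lemma largestJob_le_iff_mem_ending {ω : Ω} {k : ℕ} (hω : ω ∈ ⋃ j, ending V τ k Set.univ j)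
    (x : ℝ) :
    largestJob (fun i => V i ω) (fun i => τ i ω) k ≤ x ↔ ω ∈ ⋃ j, ending V τ k (Set.Iic x) j := by
  obtain ⟨j, hj⟩ := Set.mem_iUnion.1 hω
  have hiff : ω ∈ ending V τ k (Set.Iic x) j ↔
      ∀ i ≤ j, busyIndex (fun i => V i ω) (fun i => τ i ω) i = k → V i ω ≤ x := by
    constructor
    · rintro ⟨⟨-, h⟩, h', -⟩ i hi hik
      rcases hi.lt_or_eq with hi | rfl
      · exact h i hi hik
      · exact h'
    · intro h
      exact ⟨⟨hj.1.1, fun i hi hik => h i hi.le hik⟩, h j le_rfl hj.1.1, hj.2.2⟩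
  rw [largestJob_le_iff _ _ hj.1.1 hj.2.2, ← hiff]
  refine ⟨fun h => Set.mem_iUnion.2 ⟨j, h⟩, fun h => ?_⟩
  obtain ⟨i, hi⟩ := Set.mem_iUnion.1 h
  by_cases hij : i = j
  · exact hij ▸ hi
  · exact absurd hj (Set.disjoint_left.1 (disjoint_ending k Set.univ hij) (ending_subset _ _ _ hi))

/-! ### Measurability -/

lemma measurable_past_V {i j : ℕ} (h : i < j) : Measurable[past V τ j] (V i) := by
  refine measurable_iff_comap_le.2 (le_sup_of_le_left ?_)
  exact le_iSup₂ (f := fun i (_ : i ∈ Set.Iio j) => MeasurableSpace.comap (V i) inferInstance) i h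

lemma measurable_past_τ {i j : ℕ} (h : i ≤ j) : Measurable[past V τ j] (τ i) := by
  refine measurable_iff_comap_le.2 (le_sup_of_le_right ?_)
  exact le_iSup₂ (f := fun i (_ : i ∈ Set.Iic j) => MeasurableSpace.comap (τ i) inferInstance) i h

lemma past_mono : Monotone (past V τ) := by
  intro i j hij
  refine sup_le_sup ?_ ?_
  · exact biSup_mono fun k hk => lt_of_lt_of_le hk hij
  · exact biSup_mono fun k hk => le_trans hk hij

lemma measurable_past_work (j : ℕ) : Measurable[past V τ j] (work V τ j) := by
  induction j with
  | zero => exact measurable_const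
  | succ j ih =>
    have h1 : Measurable[past V τ (j + 1)] (work V τ j) := ih.mono (past_mono (by omega)) le_rfl
    have h2 : Measurable[past V τ (j + 1)] (V j) := measurable_past_V (by omega)
    have h3 : Measurable[past V τ (j + 1)] (τ (j + 1)) := measurable_past_τ le_rfl
    exact ((h1.add h2).sub h3).max measurable_const

lemma measurable_past_period (j : ℕ) : Measurable[past V τ j] (period V τ j) := by
  induction j with
  | zero => exact measurable_const
  | succ j ih =>
    have h1 : Measurable[past V τ (j + 1)] (period V τ j) := ih.mono (past_mono (by omega)) le_rfl
    have h2 : MeasurableSet[past V τ (j + 1)] {ω | work V τ (j + 1) ω = 0} :=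
      measurable_past_work (j + 1) (measurableSet_singleton 0)
    have h3 : period V τ (j + 1) =
        fun ω => period V τ j ω + if work V τ (j + 1) ω = 0 then 1 else 0 :=
      funext fun ω => period_succ j ω
    rw [h3]
    exact h1.add (Measurable.ite h2 measurable_const measurable_const)

lemma measurableSet_past_ongoing (k : ℕ) {S : Set ℝ} (hS : MeasurableSet S) (j : ℕ) :
    MeasurableSet[past V τ j] (ongoing V τ k S j) := by
  have h : ongoing V τ k S j = {ω | period V τ j ω = k} ∩
      ⋂ i ∈ Set.Iio j, ({ω | period V τ i ω = k}ᶜ ∪ V i ⁻¹' S) := by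
    ext ω
    simp [ongoing, imp_iff_not_or]
  rw [h]
  have hp : ∀ i ≤ j, MeasurableSet[past V τ j] {ω | period V τ i ω = k} := fun i hi =>
    past_mono hi _ (measurable_past_period i (measurableSet_singleton k))
  refine MeasurableSet.inter (hp j le_rfl) (MeasurableSet.biInter (Set.to_countable _) ?_)
  intro i hi
  exact (hp i (le_of_lt hi)).compl.union (measurable_past_V hi hS)

end Chain

/-! ### The one-step identity -/

section OneStep

open scoped ENNReal

lemma lintegral_expMeasure {r : ℝ} (g : ℝ → ℝ≥0∞) (hg : Measurable g) :
    ∫⁻ t, g t ∂(expMeasure r) =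
      ∫⁻ t in Set.Ici 0, ENNReal.ofReal (r * Real.exp (-(r * t))) * g t := by
  have h : expMeasure r =
      volume.withDensity fun t => ENNReal.ofReal (exponentialPDFReal r t) := rfl
  rw [h, lintegral_withDensity_eq_lintegral_mul _
    (measurable_exponentialPDFReal r).ennreal_ofReal hg, ← lintegral_indicator measurableSet_Ici]
  refine lintegral_congr fun t => ?_
  change ENNReal.ofReal (exponentialPDFReal r t) * g t = _
  rw [← exponentialPDF, exponentialPDF_eq]
  simp only [Set.indicator_apply, Set.mem_Ici]
  split_ifs <;> simp

/-- Exponential tilting of an exponential law. -/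
lemma lintegral_exp_mul_expMeasure {r θ : ℝ} (hr : 0 < r) (hθ : θ < r) (g : ℝ → ℝ≥0∞)
    (hg : Measurable g) :
    ∫⁻ t, ENNReal.ofReal (Real.exp (θ * t)) * g t ∂(expMeasure r) =
      ENNReal.ofReal (r / (r - θ)) * ∫⁻ t, g t ∂(expMeasure (r - θ)) := by
  have h0 : 0 < r - θ := sub_pos.2 hθ
  rw [lintegral_expMeasure _ (by fun_prop), lintegral_expMeasure _ hg,
    ← lintegral_const_mul _ (by fun_prop)]
  refine lintegral_congr fun t => ?_
  rw [← mul_assoc, ← mul_assoc, ← ENNReal.ofReal_mul (by positivity),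
    ← ENNReal.ofReal_mul (by positivity)]
  congr 2
  rw [← mul_assoc, div_mul_cancel₀ _ h0.ne', mul_assoc, ← Real.exp_add]
  ring_nf

lemma expMeasure_Iio {r : ℝ} (hr : 0 < r) {u : ℝ} (hu : 0 ≤ u) :
    expMeasure r (Set.Iio u) = ENNReal.ofReal (1 - Real.exp (-(r * u))) := by
  have := isProbabilityMeasure_expMeasure hr
  have hac : expMeasure r ≪ volume := withDensity_absolutelyContinuous _ _
  have h1 : expMeasure r (Set.Iic u) = expMeasure r (Set.Iio u) :=
    measure_congr (hac.ae_eq Iio_ae_eq_Iic).symm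
  rw [← h1, ← ofReal_measureReal, ← cdf_eq_real, cdf_expMeasure_eq hr, if_pos hu]

lemma expMeasure_Ici {r : ℝ} (hr : 0 < r) {u : ℝ} (hu : 0 ≤ u) :
    expMeasure r (Set.Ici u) = ENNReal.ofReal (Real.exp (-(r * u))) := by
  have := isProbabilityMeasure_expMeasure hr
  rw [← Set.compl_Iio, prob_compl_eq_one_sub measurableSet_Iio, expMeasure_Iio hr hu,
    ← ENNReal.ofReal_one, ← ENNReal.ofReal_sub _ (by simp; positivity)]
  ring_nf

/-- The overshoot below zero of a step of exponential size is again exponential. -/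
lemma lintegral_overshoot {r θ : ℝ} (hr : 0 < r) (hθ : θ < r) {u : ℝ} (hu : 0 ≤ u) :
    ∫⁻ t, (if t < u then ENNReal.ofReal (Real.exp (-(θ * (u - t))))
      else ENNReal.ofReal (r / (r - θ))) ∂(expMeasure r) =
      ENNReal.ofReal (r / (r - θ)) * ENNReal.ofReal (Real.exp (-(θ * u))) := by
  have h0 : 0 < r - θ := sub_pos.2 hθ
  -- Above zero, tilting by `exp(θ t)` turns rate `r` into `r - θ`. The exit weight is the mean of
  -- `exp(θ X)` for `X` exponential of rate `r`, the law of the overshoot; with it the two `exp(-(r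
  -- * u))` terms cancel.
  have h1 : ∀ t, (if t < u then ENNReal.ofReal (Real.exp (-(θ * (u - t))))
      else ENNReal.ofReal (r / (r - θ))) =
      ENNReal.ofReal (Real.exp (θ * t)) *
        (ENNReal.ofReal (Real.exp (-(θ * u))) * (Set.Iio u).indicator 1 t) +
      ENNReal.ofReal (r / (r - θ)) * (Set.Ici u).indicator 1 t := by
    intro t
    by_cases ht : t < u
    · have ht' : ¬ u ≤ t := not_le.2 ht
      simp only [ht, if_true, Set.indicator_apply, Set.mem_Iio, Set.mem_Ici, ht', if_false,
        Pi.one_apply, mul_one, mul_zero, add_zero]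
      rw [← ENNReal.ofReal_mul (by positivity), ← Real.exp_add]
      ring_nf
    · have ht' : u ≤ t := not_lt.1 ht
      simp [ht, ht']
  have hm : Measurable fun t : ℝ => (Set.Iio u).indicator (1 : ℝ → ℝ≥0∞) t :=
    measurable_one.indicator measurableSet_Iio
  have hm' : Measurable fun t : ℝ => (Set.Ici u).indicator (1 : ℝ → ℝ≥0∞) t :=
    measurable_one.indicator measurableSet_Ici
  simp_rw [h1]
  rw [lintegral_add_left (by fun_prop), lintegral_exp_mul_expMeasure hr hθ _ (by fun_prop),
    lintegral_const_mul _ hm, lintegral_const_mul _ hm', lintegral_indicator_one measurableSet_Iio,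
    lintegral_indicator_one measurableSet_Ici, expMeasure_Iio h0 hu, expMeasure_Ici hr hu,
    ← mul_add, ← ENNReal.ofReal_mul (by positivity), ← ENNReal.ofReal_add _ (by positivity)]
  · congr 2
    rw [mul_sub, mul_one, ← Real.exp_add]
    ring_nf
  · refine mul_nonneg (by positivity) (sub_nonneg.2 (Real.exp_le_one_iff.2 ?_))
    have := mul_nonneg h0.le hu
    linarith

/-- Laplace transform of the service time restricted to `S`. -/
def laplaceOn (P : Measure ℝ) (S : Set ℝ) (θ : ℝ) : ℝ≥0∞ :=
  ∫⁻ v in S, ENNReal.ofReal (Real.exp (-(θ * v))) ∂P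

variable {P : Measure ℝ}

/-- By memorylessness the exit payoff does not depend on the level, which makes `exp(-θ w)` an
eigenfunction of the killed step. -/
lemma lintegral_step (hP : ∀ᵐ v ∂P, 0 ≤ v) {S : Set ℝ} (hS : MeasurableSet S) {r θ : ℝ}
    (hr : 0 < r) (hθ : θ < r) {w : ℝ} (hw : 0 ≤ w) :
    ∫⁻ p, S.indicator 1 p.1 * (if p.2 < w + p.1 then
        ENNReal.ofReal (Real.exp (-(θ * (w + p.1 - p.2))))
      else ENNReal.ofReal (r / (r - θ))) ∂(P.prod (expMeasure r)) =
      ENNReal.ofReal (r / (r - θ)) * laplaceOn P S θ * ENNReal.ofReal (Real.exp (-(θ * w))) := by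
  have := isProbabilityMeasure_expMeasure hr
  have hind : Measurable (S.indicator (1 : ℝ → ℝ≥0∞)) := measurable_one.indicator hS
  rw [lintegral_prod]
  swap
  · refine Measurable.aemeasurable ((hind.comp measurable_fst).mul (Measurable.ite ?_ (by fun_prop) measurable_const))
    exact measurableSet_lt measurable_snd (by fun_prop)
  have h1 : ∀ᵐ v ∂P, ∫⁻ t, S.indicator 1 v * (if t < w + v then
        ENNReal.ofReal (Real.exp (-(θ * (w + v - t))))
      else ENNReal.ofReal (r / (r - θ))) ∂(expMeasure r) =
      (ENNReal.ofReal (r / (r - θ)) * ENNReal.ofReal (Real.exp (-(θ * w)))) *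
        S.indicator (fun v => ENNReal.ofReal (Real.exp (-(θ * v)))) v := by
    filter_upwards [hP] with v hv
    rw [lintegral_const_mul, lintegral_overshoot hr hθ (add_nonneg hw hv)]
    · by_cases hvS : v ∈ S
      · simp only [hvS, Set.indicator_of_mem, Pi.one_apply, one_mul]
        rw [mul_assoc, ← ENNReal.ofReal_mul (Real.exp_pos _).le, ← Real.exp_add]
        ring_nf
      · simp [hvS]
    · exact Measurable.ite (measurableSet_lt measurable_id measurable_const) (by fun_prop)
        measurable_const
  rw [lintegral_congr_ae h1, lintegral_const_mul, lintegral_indicator hS, laplaceOn]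
  · ring
  · exact Measurable.indicator (by fun_prop) hS

/-- The period stops when the interarrival time is at least `w + v`, an event of probability `exp(-r
(w + v))`. This plays the role of the exponent `θ = r`, where the factor of `lintegral_step`
degenerates. -/
lemma lintegral_stop (hP : ∀ᵐ v ∂P, 0 ≤ v) {S : Set ℝ} (hS : MeasurableSet S) {r : ℝ}
    (hr : 0 < r) {w : ℝ} (hw : 0 ≤ w) :
    ∫⁻ p, S.indicator 1 p.1 * (if p.2 < w + p.1 then 0 else 1) ∂(P.prod (expMeasure r)) =
      laplaceOn P S r * ENNReal.ofReal (Real.exp (-(r * w))) := by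
  have := isProbabilityMeasure_expMeasure hr
  have hind : Measurable (S.indicator (1 : ℝ → ℝ≥0∞)) := measurable_one.indicator hS
  rw [lintegral_prod]
  swap
  · refine Measurable.aemeasurable ((hind.comp measurable_fst).mul (Measurable.ite ?_ (by fun_prop) measurable_const))
    exact measurableSet_lt measurable_snd (by fun_prop)
  have h1 : ∀ᵐ v ∂P, ∫⁻ t, S.indicator 1 v * (if t < w + v then 0 else 1) ∂(expMeasure r) =
      ENNReal.ofReal (Real.exp (-(r * w))) *
        S.indicator (fun v => ENNReal.ofReal (Real.exp (-(r * v)))) v := by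
    filter_upwards [hP] with v hv
    have h2 : ∀ t, (if t < w + v then (0 : ℝ≥0∞) else 1) = (Set.Ici (w + v)).indicator 1 t := by
      intro t
      by_cases ht : t < w + v
      · simp [ht]
      · simp [ht, not_lt.1 ht]
    simp_rw [h2]
    rw [lintegral_const_mul _ (measurable_one.indicator measurableSet_Ici),
      lintegral_indicator_one measurableSet_Ici, expMeasure_Ici hr (add_nonneg hw hv)]
    by_cases hvS : v ∈ S
    · simp only [hvS, Set.indicator_of_mem, Pi.one_apply, one_mul]
      rw [← ENNReal.ofReal_mul (Real.exp_pos _).le, ← Real.exp_add]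
      ring_nf
    · simp [hvS]
  rw [lintegral_congr_ae h1, lintegral_const_mul, lintegral_indicator hS, laplaceOn]
  · ring
  · exact Measurable.indicator (by fun_prop) hS

end OneStep

/-! ### Laws of the busy periods -/

section Law

open scoped ENNReal

variable {Ω : Type*} [MeasurableSpace Ω]

/-- Service times `V` with law `P` and interarrival times `τ` exponential with rate `r`, such that
the service time of each job and the time to the next arrival are independent of each other and of
the past. -/
structure IsPoissonQueue (μ : Measure Ω) (V τ : ℕ → Ω → ℝ) (P : Measure ℝ) (r : ℝ) : Prop where
  measurable_service : ∀ i, Measurable (V i)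
  measurable_interarrival : ∀ i, Measurable (τ i)
  indep : ∀ j, Indep (past V τ j)
    (MeasurableSpace.comap (fun ω => (V j ω, τ (j + 1) ω)) inferInstance) μ
  map_eq : ∀ j, μ.map (fun ω => (V j ω, τ (j + 1) ω)) = P.prod (expMeasure r)
  rate_pos : 0 < r
  service_nonneg : ∀ᵐ v ∂P, 0 ≤ v

/-- Laplace transform of the work found by job `j` when it belongs to the `k`-th busy period and
the service times in that busy period have been in `S` so far. -/
def workLaplace (μ : Measure Ω) (V τ : ℕ → Ω → ℝ) (k : ℕ) (S : Set ℝ) (θ : ℝ) (j : ℕ) : ℝ≥0∞ :=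
  ∫⁻ ω in ongoing V τ k S j, ENNReal.ofReal (Real.exp (-(θ * work V τ j ω))) ∂μ

namespace IsPoissonQueue

variable {μ : Measure Ω} {V τ : ℕ → Ω → ℝ} {P : Measure ℝ} {r : ℝ}

lemma past_le (h : IsPoissonQueue μ V τ P r) (j : ℕ) : past V τ j ≤ ‹MeasurableSpace Ω› :=
  sup_le (iSup₂_le fun i _ => (h.measurable_service i).comap_le)
    (iSup₂_le fun i _ => (h.measurable_interarrival i).comap_le)

lemma measurable_work (h : IsPoissonQueue μ V τ P r) (j : ℕ) : Measurable (work V τ j) :=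
  (measurable_past_work j).mono (h.past_le j) le_rfl

lemma measurableSet_ongoing (h : IsPoissonQueue μ V τ P r) (k : ℕ) {S : Set ℝ}
    (hS : MeasurableSet S) (j : ℕ) : MeasurableSet (ongoing V τ k S j) :=
  h.past_le j _ (measurableSet_past_ongoing k hS j)

lemma measurableSet_starting (h : IsPoissonQueue μ V τ P r) (k j : ℕ) :
    MeasurableSet (starting V τ k j) :=
  h.past_le j _ (MeasurableSet.inter (measurable_past_period j (measurableSet_singleton k))
    (measurable_past_work j (measurableSet_singleton 0)))

lemma measurableSet_ending (h : IsPoissonQueue μ V τ P r) (k : ℕ) {S : Set ℝ}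
    (hS : MeasurableSet S) (j : ℕ) : MeasurableSet (ending V τ k S j) :=
  (h.measurableSet_ongoing k hS j).inter
    ((h.measurable_service j hS).inter (h.measurable_work (j + 1) (measurableSet_singleton 0)))

/-- Integrating out the current service time and the next interarrival time. -/
lemma setLIntegral_past [IsProbabilityMeasure μ] [IsProbabilityMeasure P]
    (h : IsPoissonQueue μ V τ P r) {j : ℕ} {C : Set Ω} (hC : MeasurableSet[past V τ j] C)
    {F : ℝ → ℝ × ℝ → ℝ≥0∞} (hF : Measurable (Function.uncurry F)) :
    ∫⁻ ω in C, F (work V τ j ω) (V j ω, τ (j + 1) ω) ∂μ =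
      ∫⁻ ω in C, ∫⁻ p, F (work V τ j ω) p ∂(P.prod (expMeasure r)) ∂μ := by
  have := isProbabilityMeasure_expMeasure h.rate_pos
  -- Carrying the indicator of `C` along with the work turns the event into a function of the past,
  -- so independence becomes a product law.
  set g : Ω → ℝ × ℝ≥0∞ := fun ω => (work V τ j ω, C.indicator (fun _ => 1) ω) with hg
  set X : Ω → ℝ × ℝ := fun ω => (V j ω, τ (j + 1) ω) with hX
  have h1m : Measurable[past V τ j] fun _ : Ω => (1 : ℝ≥0∞) := measurable_const
  have hgm : Measurable[past V τ j] g := (measurable_past_work j).prodMk (h1m.indicator hC)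
  have hgm' : Measurable g := hgm.mono (h.past_le j) le_rfl
  have hXm : Measurable X := (h.measurable_service j).prodMk (h.measurable_interarrival (j + 1))
  have hC' : MeasurableSet C := h.past_le j _ hC
  have hind : IndepFun g X μ := by
    rw [IndepFun_iff_Indep]
    exact indep_of_indep_of_le_left (h.indep j) hgm.comap_le
  have hmap := (indepFun_iff_map_prod_eq_prod_map_map hgm'.aemeasurable hXm.aemeasurable).1 hind
  have hG : Measurable fun q : (ℝ × ℝ≥0∞) × (ℝ × ℝ) => q.1.2 * F q.1.1 q.2 :=
    (measurable_snd.comp measurable_fst).mul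
      (hF.comp ((measurable_fst.comp measurable_fst).prodMk measurable_snd))
  have hG1 : Measurable fun a : ℝ × ℝ≥0∞ =>
      ∫⁻ p, a.2 * F a.1 p ∂(P.prod (expMeasure r)) := hG.lintegral_prod_right'
  have e1 : ∫⁻ ω in C, F (work V τ j ω) (X ω) ∂μ =
      ∫⁻ q, q.1.2 * F q.1.1 q.2 ∂(μ.map fun ω => (g ω, X ω)) := by
    rw [lintegral_map hG (hgm'.prodMk hXm), ← lintegral_indicator hC']
    refine lintegral_congr fun ω => ?_
    by_cases hω : ω ∈ C <;> simp [hg, hω]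
  have e2 : ∫⁻ ω in C, ∫⁻ p, F (work V τ j ω) p ∂(P.prod (expMeasure r)) ∂μ =
      ∫⁻ a, ∫⁻ p, a.2 * F a.1 p ∂(P.prod (expMeasure r)) ∂(μ.map g) := by
    rw [lintegral_map hG1 hgm', ← lintegral_indicator hC']
    refine lintegral_congr fun ω => ?_
    by_cases hω : ω ∈ C <;> simp [hg, hω]
  rw [e1, e2, hmap, h.map_eq, lintegral_prod _ hG.aemeasurable]

/-- One step of the tilted chain. -/
lemma workLaplace_step [IsProbabilityMeasure μ] [IsProbabilityMeasure P]
    (h : IsPoissonQueue μ V τ P r) (k : ℕ) {S : Set ℝ} (hS : MeasurableSet S) {θ : ℝ}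
    (hθ : θ < r) (j : ℕ) :
    ENNReal.ofReal (r / (r - θ)) * laplaceOn P S θ * workLaplace μ V τ k S θ j +
        μ (starting V τ k (j + 1)) =
      workLaplace μ V τ k S θ (j + 1) +
        ENNReal.ofReal (r / (r - θ)) * μ (ending V τ k S j) := by
  have hW := h.measurable_work (j + 1)
  have hA : MeasurableSet {ω | V j ω ∈ S ∧ work V τ (j + 1) ω ≠ 0} :=
    (h.measurable_service j hS).inter (hW (measurableSet_singleton 0)).compl
  have hE : MeasurableSet {ω | V j ω ∈ S ∧ work V τ (j + 1) ω = 0} :=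
    (h.measurable_service j hS).inter (hW (measurableSet_singleton 0))
  set F : ℝ → ℝ × ℝ → ℝ≥0∞ := fun w p => S.indicator 1 p.1 * (if p.2 < w + p.1 then
        ENNReal.ofReal (Real.exp (-(θ * (w + p.1 - p.2))))
      else ENNReal.ofReal (r / (r - θ))) with hF
  have hFm : Measurable (Function.uncurry F) := by
    refine Measurable.mul ((measurable_one.indicator hS).comp (by fun_prop)) (Measurable.ite ?_ ?_
      measurable_const)
    · exact measurableSet_lt (by fun_prop) (by fun_prop)
    · fun_prop
  have e1 : ENNReal.ofReal (r / (r - θ)) * laplaceOn P S θ * workLaplace μ V τ k S θ j =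
      ∫⁻ ω in ongoing V τ k S j, F (work V τ j ω) (V j ω, τ (j + 1) ω) ∂μ := by
    rw [h.setLIntegral_past (measurableSet_past_ongoing k hS j) hFm, workLaplace,
      ← lintegral_const_mul _ (by have := h.measurable_work j; fun_prop)]
    exact lintegral_congr fun ω =>
      (lintegral_step h.service_nonneg hS h.rate_pos hθ (work_nonneg j ω)).symm
  have e2 : ∀ ω, F (work V τ j ω) (V j ω, τ (j + 1) ω) =
      {ω | V j ω ∈ S ∧ work V τ (j + 1) ω ≠ 0}.indicator
        (fun ω => ENNReal.ofReal (Real.exp (-(θ * work V τ (j + 1) ω)))) ω +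
      {ω | V j ω ∈ S ∧ work V τ (j + 1) ω = 0}.indicator
        (fun _ => ENNReal.ofReal (r / (r - θ))) ω := by
    intro ω
    by_cases hv : V j ω ∈ S
    · by_cases h0 : work V τ (j + 1) ω = 0
      · simp [hF, hv, h0, (work_succ_eq_zero_iff j ω).1 h0]
      · have h1 := not_not.1 (mt (work_succ_eq_zero_iff j ω).2 h0)
        have h2 : work V τ (j + 1) ω = work V τ j ω + V j ω - τ (j + 1) ω := by
          rw [work_succ, max_eq_left]
          linarith
        simp [hF, hv, h1, h0, ← h2]
    · simp [hF, hv]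
  have e3 : ∫⁻ ω in starting V τ k (j + 1),
      ENNReal.ofReal (Real.exp (-(θ * work V τ (j + 1) ω))) ∂μ = μ (starting V τ k (j + 1)) := by
    rw [← setLIntegral_one]
    refine setLIntegral_congr_fun (h.measurableSet_starting k (j + 1)) fun ω hω => ?_
    simp [hω.2]
  have hdisj : Disjoint (ongoing V τ k S j ∩ {ω | V j ω ∈ S ∧ work V τ (j + 1) ω ≠ 0})
      (starting V τ k (j + 1)) :=
    Set.disjoint_left.2 fun ω h1 h2 => h1.2.2 h2.2
  rw [e1, lintegral_congr e2, lintegral_add_left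
    (Measurable.indicator (by fun_prop) hA), setLIntegral_indicator hA, setLIntegral_indicator hE,
    setLIntegral_const, workLaplace, ongoing_succ,
    lintegral_union (h.measurableSet_starting k (j + 1)) hdisj, e3, ending, Set.inter_comm,
    Set.inter_comm (ongoing V τ k S j) {ω | V j ω ∈ S ∧ work V τ (j + 1) ω = 0}]
  ring

/-- Summability of the ending probabilities will thereby control the work transform at `r`. -/
lemma measure_ending [IsProbabilityMeasure μ] [IsProbabilityMeasure P]
    (h : IsPoissonQueue μ V τ P r) (k : ℕ) {S : Set ℝ} (hS : MeasurableSet S) (j : ℕ) :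
    μ (ending V τ k S j) = laplaceOn P S r * workLaplace μ V τ k S r j := by
  have hE : MeasurableSet {ω | V j ω ∈ S ∧ work V τ (j + 1) ω = 0} :=
    (h.measurable_service j hS).inter (h.measurable_work (j + 1) (measurableSet_singleton 0))
  set F : ℝ → ℝ × ℝ → ℝ≥0∞ := fun w p =>
    S.indicator 1 p.1 * (if p.2 < w + p.1 then 0 else 1) with hF
  have hFm : Measurable (Function.uncurry F) := by
    refine Measurable.mul ((measurable_one.indicator hS).comp (by fun_prop)) (Measurable.ite ?_
      measurable_const measurable_const)
    exact measurableSet_lt (by fun_prop) (by fun_prop)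
  have e1 : laplaceOn P S r * workLaplace μ V τ k S r j =
      ∫⁻ ω in ongoing V τ k S j, F (work V τ j ω) (V j ω, τ (j + 1) ω) ∂μ := by
    rw [h.setLIntegral_past (measurableSet_past_ongoing k hS j) hFm, workLaplace,
      ← lintegral_const_mul _ (by have := h.measurable_work j; fun_prop)]
    exact lintegral_congr fun ω =>
      (lintegral_stop h.service_nonneg hS h.rate_pos (work_nonneg j ω)).symm
  have e2 : ∀ ω, F (work V τ j ω) (V j ω, τ (j + 1) ω) =
      {ω | V j ω ∈ S ∧ work V τ (j + 1) ω = 0}.indicator 1 ω := by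
    intro ω
    by_cases hv : V j ω ∈ S <;> by_cases h0 : work V τ (j + 1) ω = 0
    · simp [hF, hv, h0, (work_succ_eq_zero_iff j ω).1 h0]
    · simp [hF, h0, not_not.1 (mt (work_succ_eq_zero_iff j ω).2 h0)]
    · simp [hF, hv]
    · simp [hF, hv]
  rw [e1, lintegral_congr e2, setLIntegral_indicator hE]
  simp only [Pi.one_apply, setLIntegral_one]
  rw [ending, Set.inter_comm]

end IsPoissonQueue

end Law

/-! ### Recurrence of the busy periods and the exact law of their largest jobs -/

section Recurrence

open scoped ENNReal

variable {Ω : Type*} [MeasurableSpace Ω] {μ : Measure Ω} {V τ : ℕ → Ω → ℝ} {P : Measure ℝ} {r : ℝ}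

lemma laplaceOn_ne_zero {S : Set ℝ} (hS : P S ≠ 0) (θ : ℝ) : laplaceOn P S θ ≠ 0 := by
  intro h
  rw [laplaceOn, lintegral_eq_zero_iff (by fun_prop)] at h
  refine hS (Measure.restrict_eq_zero.1 (ae_eq_bot.1 ?_))
  refine Filter.empty_mem_iff_bot.1 ?_
  filter_upwards [h] with v hv
  exact absurd hv (by simp [Real.exp_pos])

lemma laplaceOn_le_one [IsProbabilityMeasure P] (hP : ∀ᵐ v ∂P, 0 ≤ v) (S : Set ℝ) {θ : ℝ}
    (hθ : 0 ≤ θ) : laplaceOn P S θ ≤ 1 := by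
  calc laplaceOn P S θ ≤ ∫⁻ v, ENNReal.ofReal (Real.exp (-(θ * v))) ∂P :=
        setLIntegral_le_lintegral _ _
    _ ≤ ∫⁻ _, 1 ∂P := by
        refine lintegral_mono_ae ?_
        filter_upwards [hP] with v hv
        rw [← ENNReal.ofReal_one]
        refine ENNReal.ofReal_le_ofReal (Real.exp_le_one_iff.2 ?_)
        have := mul_nonneg hθ hv
        linarith
    _ = 1 := by simp

/-- In a queue with load at most one, the tilted step has total mass at least one. -/
lemma one_le_tilted_mass [IsProbabilityMeasure P] (hP : ∀ᵐ v ∂P, 0 ≤ v)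
    (hint : Integrable (fun v => v) P) {θ : ℝ} (hθ0 : 0 < θ) (hθ : θ < r)
    (hload : r * ∫ v, v ∂P ≤ 1) :
    1 ≤ ENNReal.ofReal (r / (r - θ)) * laplaceOn P Set.univ θ := by
  have h0 : 0 < r - θ := sub_pos.2 hθ
  have hr : 0 < r := hθ0.trans hθ
  have hi : Integrable (fun v => Real.exp (-(θ * v))) P := by
    refine (integrable_const (1 : ℝ)).mono (by fun_prop) ?_
    filter_upwards [hP] with v hv
    have := mul_nonneg hθ0.le hv
    simp only [Real.norm_eq_abs, Real.abs_exp, abs_one]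
    exact Real.exp_le_one_iff.2 (by linarith)
  -- From `exp(-s) ≥ 1 - s`. The bound then needed, `r (1 - θ E[V]) ≥ r - θ`, is exactly the load
  -- condition.
  have h1 : 1 - θ * ∫ v, v ∂P ≤ ∫ v, Real.exp (-(θ * v)) ∂P := by
    have h2 : ∫ v, (1 - θ * v) ∂P = 1 - θ * ∫ v, v ∂P := by
      rw [integral_sub (integrable_const _) (hint.const_mul θ), integral_const_mul]
      simp
    rw [← h2]
    refine integral_mono ((integrable_const _).sub (hint.const_mul θ)) hi fun v => ?_
    have := Real.add_one_le_exp (-(θ * v))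
    simp only
    linarith
  rw [laplaceOn, Measure.restrict_univ,
    ← ofReal_integral_eq_lintegral_ofReal hi (ae_of_all _ fun v => (Real.exp_pos _).le),
    ← ENNReal.ofReal_mul (by positivity), ← ENNReal.ofReal_one]
  refine ENNReal.ofReal_le_ofReal ?_
  rw [div_mul_eq_mul_div, le_div_iff₀ h0]
  nlinarith

namespace IsPoissonQueue

lemma workLaplace_zero (h : IsPoissonQueue μ V τ P r) (k : ℕ) {S : Set ℝ} (hS : MeasurableSet S)
    (θ : ℝ) : workLaplace μ V τ k S θ 0 = μ (starting V τ k 0) := by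
  rw [workLaplace, ← ongoing_zero k S, ← setLIntegral_one]
  refine setLIntegral_congr_fun (h.measurableSet_ongoing k hS 0) fun ω _ => ?_
  simp [work, workAtArrival]

lemma tsum_ending_le_one [IsProbabilityMeasure μ] (h : IsPoissonQueue μ V τ P r) (k : ℕ)
    {S : Set ℝ} (hS : MeasurableSet S) : ∑' j, μ (ending V τ k S j) ≤ 1 := by
  rw [← measure_iUnion (disjoint_ending k S) fun j => h.measurableSet_ending k hS j]
  exact prob_le_one

variable [IsProbabilityMeasure μ] [IsProbabilityMeasure P]

/-- `workLaplace_step` is summed over jobs, kept in additive form because subtraction in `ℝ≥0∞`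
truncates. The ranges differ by one: job `n` may have opened the period, but only jobs before it
have had their chance to end it. -/
lemma sum_starting_le (h : IsPoissonQueue μ V τ P r) (k : ℕ) {S : Set ℝ} (hS : MeasurableSet S)
    {θ : ℝ} (hθ : θ < r) (hmass : 1 ≤ ENNReal.ofReal (r / (r - θ)) * laplaceOn P S θ) (n : ℕ) :
    ∑ j ∈ Finset.range (n + 1), μ (starting V τ k j) ≤ workLaplace μ V τ k S θ n +
      ENNReal.ofReal (r / (r - θ)) * ∑ j ∈ Finset.range n, μ (ending V τ k S j) := by
  induction n with
  | zero => simp [h.workLaplace_zero k hS]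
  | succ n ih =>
    rw [Finset.sum_range_succ, Finset.sum_range_succ (fun j => μ (ending V τ k S j)), mul_add, add_comm (_ * _) (_ * _),
      ← add_assoc, ← h.workLaplace_step k hS hθ n, add_right_comm]
    gcongr
    refine ih.trans ?_
    gcongr
    exact le_mul_of_one_le_left zero_le hmass

lemma le_sum_starting (h : IsPoissonQueue μ V τ P r) (k : ℕ) {S : Set ℝ} (hS : MeasurableSet S)
    {θ : ℝ} (hθ : θ < r) (hmass : ENNReal.ofReal (r / (r - θ)) * laplaceOn P S θ ≤ 1) (n : ℕ) :
    workLaplace μ V τ k S θ n +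
      ENNReal.ofReal (r / (r - θ)) * ∑ j ∈ Finset.range n, μ (ending V τ k S j) ≤
    ∑ j ∈ Finset.range (n + 1), μ (starting V τ k j) := by
  induction n with
  | zero => simp [h.workLaplace_zero k hS]
  | succ n ih =>
    rw [Finset.sum_range_succ, Finset.sum_range_succ _ (n + 1), mul_add,
      add_comm (_ * _) (_ * _), ← add_assoc, ← h.workLaplace_step k hS hθ n, add_right_comm]
    gcongr
    refine le_trans ?_ ih
    gcongr
    exact mul_le_of_le_one_left zero_le hmass

/-- A busy period does not last forever with work remaining bounded in probability. -/
lemma tendsto_workLaplace (h : IsPoissonQueue μ V τ P r) (k : ℕ) {S : Set ℝ}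
    (hS : MeasurableSet S) (hPS : P S ≠ 0) {θ : ℝ} (hθ0 : 0 < θ) :
    Tendsto (workLaplace μ V τ k S θ) atTop (𝓝 0) := by
  have hr := h.rate_pos
  -- The ending events are disjoint, so their probabilities are summable.
  have h1 : Tendsto (fun j => μ (ending V τ k S j)) atTop (𝓝 0) :=
    ENNReal.tendsto_atTop_zero_of_tsum_ne_top
      (ne_top_of_le_ne_top ENNReal.one_ne_top (h.tsum_ending_le_one k hS))
  have hL0 := laplaceOn_ne_zero hPS r
  have hLt : laplaceOn P S r ≠ ∞ :=
    ne_top_of_le_ne_top ENNReal.one_ne_top (laplaceOn_le_one h.service_nonneg S hr.le)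
  have h2 : Tendsto (workLaplace μ V τ k S r) atTop (𝓝 0) := by
    have h3 := ENNReal.Tendsto.const_mul (a := (laplaceOn P S r)⁻¹) h1
      (Or.inr (ENNReal.inv_ne_top.2 hL0))
    simp_rw [h.measure_ending k hS, ← mul_assoc, ENNReal.inv_mul_cancel hL0 hLt, one_mul,
      mul_zero] at h3
    exact h3
  have h4 : ∀ δ : ℝ, 0 < δ → ∃ c : ℝ, ∀ j, workLaplace μ V τ k S θ j ≤
      ENNReal.ofReal δ + ENNReal.ofReal c * workLaplace μ V τ k S r j := by
    intro δ hδ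
    -- The level where `exp(-θ K) = δ`. Work above `K` contributes at most `δ`; below it the
    -- integrand is at most 1, hence at most `exp(r K) exp(-r W)`.
    set K : ℝ := -Real.log δ / θ with hK
    refine ⟨Real.exp (r * K), fun j => ?_⟩
    have hm := h.measurable_work j
    calc workLaplace μ V τ k S θ j ≤ ∫⁻ ω in ongoing V τ k S j, (ENNReal.ofReal δ +
          ENNReal.ofReal (Real.exp (r * K)) *
            ENNReal.ofReal (Real.exp (-(r * work V τ j ω)))) ∂μ := by
          refine lintegral_mono fun ω => ?_
          simp only
          rw [← ENNReal.ofReal_mul (Real.exp_pos _).le,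
            ← ENNReal.ofReal_add hδ.le (by positivity), ← Real.exp_add]
          refine ENNReal.ofReal_le_ofReal ?_
          have hw : 0 ≤ work V τ j ω := work_nonneg j ω
          rcases le_total K (work V τ j ω) with hle | hle
          · have h5 : Real.exp (-(θ * work V τ j ω)) ≤ δ := by
              rw [← Real.le_log_iff_exp_le hδ]
              have : -Real.log δ ≤ θ * work V τ j ω := by
                rw [hK, div_le_iff₀ hθ0] at hle
                linarith
              linarith
            have := Real.exp_pos (r * K + -(r * work V τ j ω))
            linarith
          · have h5 : Real.exp (-(θ * work V τ j ω)) ≤ 1 := by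
              refine Real.exp_le_one_iff.2 ?_
              have := mul_nonneg hθ0.le hw
              linarith
            have h6 : 1 ≤ Real.exp (r * K + -(r * work V τ j ω)) := by
              refine Real.one_le_exp ?_
              have := mul_le_mul_of_nonneg_left hle hr.le
              linarith
            linarith
      _ ≤ _ := by
          rw [lintegral_add_left measurable_const, setLIntegral_const,
            lintegral_const_mul _ (by fun_prop), workLaplace]
          gcongr
          exact mul_le_of_le_one_right zero_le prob_le_one
  rw [ENNReal.tendsto_nhds_zero]
  intro ε hε
  obtain ⟨δ, hδ, hδε⟩ : ∃ δ : ℝ, 0 < δ ∧ ENNReal.ofReal δ < ε := by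
    obtain ⟨δ, hδ, hδε⟩ := ENNReal.lt_iff_exists_nnreal_btwn.1 hε
    refine ⟨δ, by exact_mod_cast hδ, by simpa using hδε⟩
  obtain ⟨c, hc⟩ := h4 δ hδ
  have h5 : Tendsto (fun j => ENNReal.ofReal δ + ENNReal.ofReal c * workLaplace μ V τ k S r j)
      atTop (𝓝 (ENNReal.ofReal δ)) := by
    have h6 := ENNReal.Tendsto.const_mul (a := ENNReal.ofReal c) h2 (Or.inr ENNReal.ofReal_ne_top)
    rw [mul_zero] at h6
    simpa using h6.const_add (ENNReal.ofReal δ)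
  filter_upwards [h5.eventually_lt_const hδε] with j hj
  exact (hc j).trans hj.le

lemma tendsto_sum_starting (μ : Measure Ω) (V τ : ℕ → Ω → ℝ) (k : ℕ) :
    Tendsto (fun n => ∑ j ∈ Finset.range (n + 1), μ (starting V τ k j)) atTop
      (𝓝 (∑' j, μ (starting V τ k j))) :=
  (tendsto_add_atTop_iff_nat 1).2 (ENNReal.tendsto_nat_tsum fun j => μ (starting V τ k j))

lemma tendsto_workLaplace_add_sum_ending (h : IsPoissonQueue μ V τ P r) (k : ℕ) {S : Set ℝ}
    (hS : MeasurableSet S) (hPS : P S ≠ 0) {θ : ℝ} (hθ0 : 0 < θ) :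
    Tendsto (fun n => workLaplace μ V τ k S θ n +
      ENNReal.ofReal (r / (r - θ)) * ∑ j ∈ Finset.range n, μ (ending V τ k S j)) atTop
      (𝓝 (ENNReal.ofReal (r / (r - θ)) * ∑' j, μ (ending V τ k S j))) := by
  have h1 := ENNReal.Tendsto.const_mul (a := ENNReal.ofReal (r / (r - θ)))
    (ENNReal.tendsto_nat_tsum fun j => μ (ending V τ k S j)) (Or.inr ENNReal.ofReal_ne_top)
  simpa using (h.tendsto_workLaplace k hS hPS hθ0).add h1

lemma tsum_starting_succ (μ : Measure Ω) (V τ : ℕ → Ω → ℝ) (k : ℕ) :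
    ∑' j, μ (starting V τ (k + 1) j) = ∑' j, μ (ending V τ k Set.univ j) := by
  rw [tsum_eq_zero_add' ENNReal.summable, starting_succ_zero, measure_empty, zero_add]
  simp_rw [starting_succ_succ]

/-- With load at most one, every busy period almost surely occurs. -/
lemma tsum_starting (h : IsPoissonQueue μ V τ P r) (hint : Integrable (fun v => v) P)
    (hload : r * ∫ v, v ∂P ≤ 1) (k : ℕ) : ∑' j, μ (starting V τ k j) = 1 := by
  induction k with
  | zero =>
    rw [tsum_eq_single 0]
    · rw [starting_zero_zero, measure_univ]
    · intro j hj
      obtain ⟨m, rfl⟩ := Nat.exists_eq_succ_of_ne_zero hj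
      rw [Nat.succ_eq_add_one, starting_zero_succ, measure_empty]
  | succ k ih =>
    have hr := h.rate_pos
    rw [tsum_starting_succ]
    set e := ∑' j, μ (ending V τ k Set.univ j) with he
    have he1 : e ≤ 1 := h.tsum_ending_le_one k MeasurableSet.univ
    have hetop : e ≠ ∞ := ne_top_of_le_ne_top ENNReal.one_ne_top he1
    refine le_antisymm he1 ?_
    -- The whole starting mass is 1, so `1 ≤ r / (r - θ) * e` for each `θ`; a small `θ` then forces
    -- `e = 1`.
    have key : ∀ θ, 0 < θ → θ < r → r - θ ≤ r * e.toReal := by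
      intro θ hθ0 hθ
      have h0 : 0 < r - θ := sub_pos.2 hθ
      have h1 := le_of_tendsto_of_tendsto' (tendsto_sum_starting μ V τ k)
        (h.tendsto_workLaplace_add_sum_ending k MeasurableSet.univ (by simp) hθ0)
        (h.sum_starting_le k MeasurableSet.univ hθ
          (one_le_tilted_mass h.service_nonneg hint hθ0 hθ hload))
      rw [ih, ← he, ← ENNReal.ofReal_toReal hetop, ← ENNReal.ofReal_mul (by positivity),
        ENNReal.one_le_ofReal, div_mul_eq_mul_div, le_div_iff₀ h0] at h1
      linarith
    rw [← ENNReal.ofReal_toReal hetop, ENNReal.one_le_ofReal]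
    by_contra! hlt
    have h2 := key (r * (1 - e.toReal) / 2) (by have := sub_pos.2 hlt; positivity)
      (by nlinarith [ENNReal.toReal_nonneg (a := e)])
    nlinarith

/-- With load at most one, every busy period is almost surely finite. -/
lemma measure_iUnion_ending_univ (h : IsPoissonQueue μ V τ P r)
    (hint : Integrable (fun v => v) P) (hload : r * ∫ v, v ∂P ≤ 1) (k : ℕ) :
    μ (⋃ j, ending V τ k Set.univ j) = 1 := by
  rw [measure_iUnion (disjoint_ending k _) fun j => h.measurableSet_ending k MeasurableSet.univ j,
    ← h.tsum_starting hint hload (k + 1), tsum_starting_succ]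

/-- The distribution function of the largest job of a busy period is a root of the fixed-point
equation of the associated branching process. -/
lemma measure_largestJob_le (h : IsPoissonQueue μ V τ P r)
    (hint : Integrable (fun v => v) P) (hload : r * ∫ v, v ∂P ≤ 1) (k : ℕ) {x q : ℝ}
    (hq0 : 0 < q) (hq1 : q < 1)
    (hq : laplaceOn P (Set.Iic x) (r * (1 - q)) = ENNReal.ofReal q) :
    μ.real {ω | largestJob (fun i => V i ω) (fun i => τ i ω) k ≤ x} = q := by
  have hr := h.rate_pos
  have hae : ∀ᵐ ω ∂μ, ω ∈ ⋃ j, ending V τ k Set.univ j :=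
    (mem_ae_iff_prob_eq_one (MeasurableSet.iUnion fun j =>
      h.measurableSet_ending k MeasurableSet.univ j)).2
      (h.measure_iUnion_ending_univ hint hload k)
  have h1 : μ {ω | largestJob (fun i => V i ω) (fun i => τ i ω) k ≤ x} =
      μ (⋃ j, ending V τ k (Set.Iic x) j) := by
    refine measure_congr ?_
    filter_upwards [hae] with ω hω
    exact propext (largestJob_le_iff_mem_ending hω x)
  have hPS : P (Set.Iic x) ≠ 0 := by
    intro h0
    rw [laplaceOn, Measure.restrict_eq_zero.2 h0, lintegral_zero_measure] at hq
    exact absurd (ENNReal.ofReal_eq_zero.1 hq.symm) (not_le.2 hq0)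
  have hθ0 : 0 < r * (1 - q) := mul_pos hr (sub_pos.2 hq1)
  have hθ : r * (1 - q) < r := by nlinarith
  have hR : r / (r - r * (1 - q)) = q⁻¹ := by
    rw [show r - r * (1 - q) = r * q by ring, div_mul_cancel_left₀ hr.ne']
  -- The root equation makes the step mass exactly 1, so both summed inequalities hold and pinch the
  -- total ending probability.
  have hmass : ENNReal.ofReal (r / (r - r * (1 - q))) * laplaceOn P (Set.Iic x) (r * (1 - q)) =
      1 := by
    rw [hq, hR, ← ENNReal.ofReal_mul (by positivity), inv_mul_cancel₀ hq0.ne', ENNReal.ofReal_one]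
  have hlim := h.tendsto_workLaplace_add_sum_ending k measurableSet_Iic hPS hθ0
  have h2 := le_antisymm
    (le_of_tendsto_of_tendsto' hlim (tendsto_sum_starting μ V τ k)
      (h.le_sum_starting k measurableSet_Iic hθ hmass.le))
    (le_of_tendsto_of_tendsto' (tendsto_sum_starting μ V τ k) hlim
      (h.sum_starting_le k measurableSet_Iic hθ hmass.ge))
  rw [h.tsum_starting hint hload k,
    ← measure_iUnion (disjoint_ending k _) fun j => h.measurableSet_ending k measurableSet_Iic j,
    ← h1, hR, ← ofReal_measureReal, ← ENNReal.ofReal_mul (by positivity), ENNReal.ofReal_eq_one]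
    at h2
  field_simp at h2
  exact h2

end IsPoissonQueue

end Recurrence

/-! ### Independence of each step from the past -/

section Input

variable {Ω : Type*} [MeasurableSpace Ω] {μ : Measure Ω}

/-- With all inputs in one independent family, the past and the fresh pair of variables become
disjoint blocks of indices. -/
lemma iIndepFun_sumElim {ι κ : Type*} {X : ι → Ω → ℝ} {Y : κ → Ω → ℝ} (hX : iIndepFun X μ)
    (hY : iIndepFun Y μ) (hXY : IndepFun (fun ω i => X i ω) (fun ω i => Y i ω) μ) :
    iIndepFun (Sum.elim X Y) μ := by
  rw [iIndepFun_iff_measure_inter_preimage_eq_mul]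
  intro S sets hsets
  have hl : ∀ i ∈ S.toLeft, MeasurableSet (sets (Sum.inl i)) := fun i hi =>
    hsets _ (Finset.mem_toLeft.1 hi)
  have hr : ∀ i ∈ S.toRight, MeasurableSet (sets (Sum.inr i)) := fun i hi =>
    hsets _ (Finset.mem_toRight.1 hi)
  have e1 : ⋂ i ∈ S, Sum.elim X Y i ⁻¹' sets i =
      ((fun ω i => X i ω) ⁻¹' ⋂ i ∈ S.toLeft, (fun f : ι → ℝ => f i) ⁻¹' sets (Sum.inl i)) ∩
        ((fun ω i => Y i ω) ⁻¹' ⋂ i ∈ S.toRight, (fun f : κ → ℝ => f i) ⁻¹' sets (Sum.inr i)) := by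
    ext ω
    simp
  have e2 : ((fun ω i => X i ω) ⁻¹' ⋂ i ∈ S.toLeft, (fun f : ι → ℝ => f i) ⁻¹' sets (Sum.inl i)) =
      ⋂ i ∈ S.toLeft, X i ⁻¹' sets (Sum.inl i) := by
    ext ω
    simp
  have e3 : ((fun ω i => Y i ω) ⁻¹' ⋂ i ∈ S.toRight, (fun f : κ → ℝ => f i) ⁻¹' sets (Sum.inr i)) =
      ⋂ i ∈ S.toRight, Y i ⁻¹' sets (Sum.inr i) := by
    ext ω
    simp
  have e4 : ∏ i ∈ S, μ (Sum.elim X Y i ⁻¹' sets i) =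
      ∏ i ∈ S.toLeft.disjSum S.toRight, μ (Sum.elim X Y i ⁻¹' sets i) := by
    rw [Finset.toLeft_disjSum_toRight]
  rw [e1, indepFun_iff_measure_inter_preimage_eq_mul.1 hXY, e2, e3,
    hX.measure_inter_preimage_eq_mul _ hl, hY.measure_inter_preimage_eq_mul _ hr, e4,
    Finset.prod_disjSum]
  · rfl
  · exact Finset.measurableSet_biInter _ fun i hi => measurable_pi_apply i (hl i hi)
  · exact Finset.measurableSet_biInter _ fun i hi => measurable_pi_apply i (hr i hi)

lemma isPoissonQueue_of_indep [IsProbabilityMeasure μ] {V τ : ℕ → Ω → ℝ} {r : ℝ} (hr : 0 < r)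
    (hV_meas : ∀ i, Measurable (V i)) (hV_nonneg : ∀ i, ∀ᵐ ω ∂μ, 0 ≤ V i ω)
    (hV_indep : iIndepFun V μ) (hV_ident : ∀ i, IdentDistrib (V i) (V 0) μ μ)
    (hτ_meas : ∀ i, Measurable (τ i)) (hτ_indep : iIndepFun τ μ)
    (hτ_law : ∀ i, μ.map (τ i) = expMeasure r)
    (hVτ : IndepFun (fun ω i => V i ω) (fun ω i => τ i ω) μ) :
    IsPoissonQueue μ V τ (μ.map (V 0)) r where
  measurable_service := hV_meas
  measurable_interarrival := hτ_meas
  indep := fun j => by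
    have hZ := iIndepFun_sumElim hV_indep hτ_indep hVτ
    have hZm : ∀ i, Measurable (Sum.elim V τ i) := by
      rintro (i | i)
      · exact hV_meas i
      · exact hτ_meas i
    set A : Set (ℕ ⊕ ℕ) := Sum.inl '' Set.Iio j ∪ Sum.inr '' Set.Iic j with hA
    set B : Set (ℕ ⊕ ℕ) := {Sum.inl j, Sum.inr (j + 1)} with hB
    have hAB : Disjoint A B := by
      rw [Set.disjoint_left]
      rintro z (⟨i, hi, rfl⟩ | ⟨i, hi, rfl⟩) hz
      · simp only [Set.mem_Iio] at hi
        simp [hB] at hz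
        omega
      · simp only [Set.mem_Iic] at hi
        simp [hB] at hz
        omega
    have hind := indep_iSup_of_disjoint (fun i => (hZm i).comap_le) hZ.iIndep hAB
    have hle : ∀ (C : Set (ℕ ⊕ ℕ)) (z : ℕ ⊕ ℕ), z ∈ C →
        MeasurableSpace.comap (Sum.elim V τ z) inferInstance ≤
          ⨆ i ∈ C, MeasurableSpace.comap (Sum.elim V τ i) (inferInstance : MeasurableSpace ℝ) :=
      fun C z hz => le_iSup₂ (f := fun i (_ : i ∈ C) =>
        MeasurableSpace.comap (Sum.elim V τ i) (inferInstance : MeasurableSpace ℝ)) z hz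
    refine indep_of_indep_of_le hind (sup_le (iSup₂_le fun i hi => ?_) (iSup₂_le fun i hi => ?_)) ?_
    · exact hle A (Sum.inl i) (Or.inl ⟨i, hi, rfl⟩)
    · exact hle A (Sum.inr i) (Or.inr ⟨i, hi, rfl⟩)
    · refine Measurable.comap_le (Measurable.prodMk ?_ ?_)
      · exact measurable_iff_comap_le.2 (hle B (Sum.inl j) (by simp [hB]))
      · exact measurable_iff_comap_le.2 (hle B (Sum.inr (j + 1)) (by simp [hB]))
  map_eq := fun j => by
    have hind : IndepFun (V j) (τ (j + 1)) μ :=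
      hVτ.comp (measurable_pi_apply j) (measurable_pi_apply (j + 1))
    rw [(indepFun_iff_map_prod_eq_prod_map_map (hV_meas j).aemeasurable
      (hτ_meas (j + 1)).aemeasurable).1 hind, (hV_ident j).map_eq, hτ_law]
  rate_pos := hr
  service_nonneg := (ae_map_iff (hV_meas 0).aemeasurable measurableSet_Ici).2 (hV_nonneg 0)

end Input

/-! ### Regularly varying tails -/

section Potter

variable {f : ℝ → ℝ} {ν : ℝ}

/-- A zero of `f` would persist to the right, and there `f z / f z` is `0 / 0 = 0`, against the
limit 1 given by `c = 1`. -/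
lemma RegularlyVarying.pos_of_antitone {α : ℝ} (hf : RegularlyVarying f α) (hanti : Antitone f)
    (h0 : ∀ x, 0 ≤ f x) (x : ℝ) : 0 < f x := by
  have h1 : ∀ᶠ z in atTop, (2⁻¹ : ℝ) < f (1 * z) / f z := by
    refine (hf 1 one_pos).eventually_const_lt ?_
    rw [Real.one_rpow]
    norm_num
  obtain ⟨z, hz, hxz⟩ := (h1.and (eventually_ge_atTop x)).exists
  refine lt_of_lt_of_le ((h0 z).lt_of_ne fun h => ?_) (hanti hxz)
  rw [← h, div_zero] at hz
  norm_num at hz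

/-- Potter's upper bound for a nonincreasing regularly varying function. -/
lemma RegularlyVarying.potter_upper (hf : RegularlyVarying f (-ν)) (hanti : Antitone f)
    (h0 : ∀ x, 0 ≤ f x) {δ : ℝ} (hδ : 0 < δ) (hδν : δ ≤ ν) :
    ∃ C x₀ : ℝ, 0 < C ∧ 0 < x₀ ∧ ∀ x ≥ x₀, ∀ s ≥ (1 : ℝ), f (s * x) ≤ C * s ^ (-(ν - δ)) * f x := by
  have hpos := hf.pos_of_antitone hanti h0
  set b : ℝ := 2 ^ (-(ν - δ)) with hb
  have hb0 : 0 < b := by positivity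
  -- The limit `2^(-ν)` is below `b`, so far out each doubling contracts `f` by `b`. Monotonicity
  -- between powers of 2 costs the factor `2^(ν-δ)`.
  have h1 : ∀ᶠ z in atTop, f (2 * z) / f z < b :=
    (hf 2 two_pos).eventually_lt_const (Real.rpow_lt_rpow_of_exponent_lt one_lt_two (by linarith))
  obtain ⟨x₁, hx₁⟩ := eventually_atTop.1 h1
  refine ⟨2 ^ (ν - δ), max x₁ 1, by positivity, by positivity, fun x hx s hs => ?_⟩
  have hx1 : x₁ ≤ x := (le_max_left _ _).trans hx
  have hx0 : 0 < x := lt_of_lt_of_le one_pos ((le_max_right _ _).trans hx)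
  have hk : ∀ k : ℕ, f (2 ^ k * x) ≤ b ^ k * f x := by
    intro k
    induction k with
    | zero => simp
    | succ k ih =>
      have h2 : x₁ ≤ 2 ^ k * x :=
        hx1.trans (le_mul_of_one_le_left hx0.le (one_le_pow₀ one_le_two))
      have h3 := hx₁ _ h2
      rw [div_lt_iff₀ (hpos _)] at h3
      calc f (2 ^ (k + 1) * x) = f (2 * (2 ^ k * x)) := by ring_nf
        _ ≤ b * f (2 ^ k * x) := h3.le
        _ ≤ b * (b ^ k * f x) := by gcongr
        _ = b ^ (k + 1) * f x := by ring
  obtain ⟨k, hk1, hk2⟩ := exists_nat_pow_near hs one_lt_two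
  have h4 : b ^ k ≤ 2 ^ (ν - δ) * s ^ (-(ν - δ)) := by
    have hs0 : 0 < s := by linarith
    have e1 : b ^ k = ((2 : ℝ) ^ k) ^ (-(ν - δ)) := by
      rw [hb, ← Real.rpow_natCast, ← Real.rpow_natCast, ← Real.rpow_mul two_pos.le,
        ← Real.rpow_mul two_pos.le, mul_comm]
    have e2 : (2 : ℝ) ^ (ν - δ) * s ^ (-(ν - δ)) = (s / 2) ^ (-(ν - δ)) := by
      rw [Real.div_rpow hs0.le two_pos.le, Real.rpow_neg two_pos.le, div_inv_eq_mul, mul_comm]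
    rw [e1, e2]
    refine Real.rpow_le_rpow_of_nonpos (by positivity) ?_ (by linarith)
    rw [pow_succ] at hk2
    linarith
  calc f (s * x) ≤ f (2 ^ k * x) := hanti (by gcongr)
    _ ≤ b ^ k * f x := hk k
    _ ≤ _ := by gcongr; exact h0 x

/-- Potter's lower bound for a nonincreasing regularly varying function. -/
lemma RegularlyVarying.potter_lower (hf : RegularlyVarying f (-ν)) (hanti : Antitone f)
    (h0 : ∀ x, 0 ≤ f x) {δ : ℝ} (hδ : 0 < δ) (hν : 0 ≤ ν) :
    ∃ C x₀ : ℝ, 0 < C ∧ 0 < x₀ ∧ ∀ x ≥ x₀, ∀ s ≥ (1 : ℝ), f x ≤ C * s ^ (ν + δ) * f (s * x) := by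
  have hpos := hf.pos_of_antitone hanti h0
  set b : ℝ := 2 ^ (ν + δ) with hb
  have hb0 : 0 < b := by positivity
  have h1 : ∀ᶠ z in atTop, b⁻¹ < f (2 * z) / f z := by
    refine (hf 2 two_pos).eventually_const_lt ?_
    rw [hb, ← Real.rpow_neg two_pos.le]
    exact Real.rpow_lt_rpow_of_exponent_lt one_lt_two (by linarith)
  obtain ⟨x₁, hx₁⟩ := eventually_atTop.1 h1
  refine ⟨2 ^ (ν + δ), max x₁ 1, by positivity, by positivity, fun x hx s hs => ?_⟩
  have hx1 : x₁ ≤ x := (le_max_left _ _).trans hx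
  have hx0 : 0 < x := lt_of_lt_of_le one_pos ((le_max_right _ _).trans hx)
  have hk : ∀ k : ℕ, f x ≤ b ^ k * f (2 ^ k * x) := by
    intro k
    induction k with
    | zero => simp
    | succ k ih =>
      have h2 : x₁ ≤ 2 ^ k * x :=
        hx1.trans (le_mul_of_one_le_left hx0.le (one_le_pow₀ one_le_two))
      have h3 := hx₁ _ h2
      rw [lt_div_iff₀ (hpos _), inv_mul_lt_iff₀ hb0] at h3
      calc f x ≤ b ^ k * f (2 ^ k * x) := ih
        _ ≤ b ^ k * (b * f (2 * (2 ^ k * x))) := by gcongr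
        _ = b ^ (k + 1) * f (2 ^ (k + 1) * x) := by ring_nf
  obtain ⟨k, hk1, hk2⟩ := exists_nat_pow_near hs one_lt_two
  have hs0 : 0 < s := by linarith
  have h4 : b ^ (k + 1) ≤ 2 ^ (ν + δ) * s ^ (ν + δ) := by
    have e1 : b ^ (k + 1) = ((2 : ℝ) ^ (k + 1)) ^ (ν + δ) := by
      rw [hb, ← Real.rpow_natCast, ← Real.rpow_natCast, ← Real.rpow_mul two_pos.le,
        ← Real.rpow_mul two_pos.le, mul_comm]
    rw [e1, ← Real.mul_rpow two_pos.le hs0.le]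
    refine Real.rpow_le_rpow (by positivity) ?_ (by linarith)
    rw [pow_succ]
    linarith
  calc f x ≤ b ^ (k + 1) * f (2 ^ (k + 1) * x) := hk (k + 1)
    _ ≤ b ^ (k + 1) * f (s * x) := by
        gcongr
        exact hanti (by gcongr)
    _ ≤ _ := by gcongr; exact h0 _

/-- Potter's bound near the origin for a bounded nonincreasing regularly varying function. -/
lemma RegularlyVarying.potter_origin (hf : RegularlyVarying f (-ν)) (hanti : Antitone f)
    (h0 : ∀ x, 0 ≤ f x) (h1 : ∀ x, f x ≤ 1) {δ : ℝ} (hδ : 0 < δ) (hν : 0 ≤ ν) :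
    ∃ C x₀ : ℝ, 0 < C ∧ 0 < x₀ ∧ ∀ x ≥ x₀, ∀ t : ℝ, 0 < t → t ≤ 1 →
      f (t * x) ≤ C * t ^ (-(ν + δ)) * f x := by
  have hpos := hf.pos_of_antitone hanti h0
  obtain ⟨C, x₀, hC, hx₀, h⟩ := hf.potter_lower hanti h0 hδ hν
  have hf0 := hpos x₀
  refine ⟨max C (C / f x₀), x₀, by positivity, hx₀, fun x hx t ht ht1 => ?_⟩
  have hx0 : 0 < x := hx₀.trans_le hx
  have htp : 0 < t ^ (-(ν + δ)) := by positivity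
  have hinv : (t⁻¹) ^ (ν + δ) = t ^ (-(ν + δ)) := by
    rw [Real.inv_rpow ht.le, Real.rpow_neg ht.le]
  -- If `t x ≥ x₀`, the lower bound applies at `t x` with ratio `1/t`. Otherwise `f ≤ 1` suffices,
  -- since `x / x₀ ≤ 1/t` bounds how small `f x` can be.
  rcases le_total x₀ (t * x) with hle | hle
  · have h2 := h (t * x) hle t⁻¹ ((one_le_inv₀ ht).2 ht1)
    rw [inv_mul_cancel_left₀ ht.ne', hinv] at h2
    refine h2.trans ?_
    gcongr
    · exact h0 x
    · exact le_max_left _ _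
  · have h2 := h x₀ le_rfl (x / x₀) ((one_le_div hx₀).2 hx)
    rw [div_mul_cancel₀ _ hx₀.ne'] at h2
    have h3 : (x / x₀) ^ (ν + δ) ≤ t ^ (-(ν + δ)) := by
      rw [← hinv]
      refine Real.rpow_le_rpow (by positivity) ?_ (by linarith)
      rw [div_le_iff₀ hx₀, ← div_eq_inv_mul, le_div_iff₀ ht]
      linarith
    calc f (t * x) ≤ 1 := h1 _
      _ = f x₀ / f x₀ := (div_self hf0.ne').symm
      _ ≤ (C * (x / x₀) ^ (ν + δ) * f x) / f x₀ := by gcongr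
      _ = C / f x₀ * (x / x₀) ^ (ν + δ) * f x := by ring
      _ ≤ max C (C / f x₀) * t ^ (-(ν + δ)) * f x := by
          gcongr
          · exact h0 x
          · exact le_max_right _ _

end Potter

/-! ### Laplace transforms through tails -/

section LayerCake

/-- Both integrands are nonnegative almost everywhere, so the identity passes through `lintegral`
without integrability: an infinite value makes both sides 0. -/
lemma integral_layercake {α : Type*} [MeasurableSpace α] (P : Measure α) [IsFiniteMeasure P]
    {Y : α → ℝ} (hY : 0 ≤ᵐ[P] Y) (hYm : Measurable Y) {g G : ℝ → ℝ} (hg : Continuous g)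
    (hg0 : ∀ t, 0 < t → 0 ≤ g t) (hG : ∀ y, 0 ≤ y → ∫ t in (0 : ℝ)..y, g t = G y)
    (hGm : Measurable G) :
    ∫ a, G (Y a) ∂P = ∫ t in Set.Ioi 0, P.real {a | t < Y a} * g t := by
  have hG0 : ∀ y, 0 ≤ y → 0 ≤ G y := by
    intro y hy
    rw [← hG y hy, intervalIntegral.integral_of_le hy]
    exact setIntegral_nonneg measurableSet_Ioc fun t ht => hg0 t ht.1
  have hgae : ∀ᵐ t ∂(volume.restrict (Set.Ioi (0 : ℝ))), 0 ≤ g t :=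
    (ae_restrict_iff' measurableSet_Ioi).2 (ae_of_all _ hg0)
  have hm : Measurable fun t : ℝ => P.real {a | t < Y a} := by
    refine Antitone.measurable fun s t hst => ?_
    exact measureReal_mono fun a ha => lt_of_le_of_lt hst ha
  rw [integral_eq_lintegral_of_nonneg_ae, integral_eq_lintegral_of_nonneg_ae]
  · congr 1
    have h1 := lintegral_comp_eq_lintegral_meas_lt_mul P hY hYm.aemeasurable
      (fun t _ => hg.intervalIntegrable 0 t) hgae
    have h2 : ∫⁻ a, ENNReal.ofReal (G (Y a)) ∂P =
        ∫⁻ a, ENNReal.ofReal (∫ t in (0 : ℝ)..Y a, g t) ∂P := by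
      refine lintegral_congr_ae ?_
      filter_upwards [hY] with a ha
      rw [hG _ ha]
    rw [h2, h1]
    refine lintegral_congr fun t => ?_
    rw [ENNReal.ofReal_mul measureReal_nonneg, ofReal_measureReal]
  · filter_upwards [hgae] with t ht using mul_nonneg measureReal_nonneg ht
  · exact (hm.mul hg.measurable).aestronglyMeasurable
  · filter_upwards [hY] with a ha using hG0 _ ha
  · exact (hGm.comp hYm).aestronglyMeasurable

/-- Second-order remainder of the exponential function at the origin. -/
def expRemainder (y : ℝ) : ℝ := Real.exp (-y) - 1 + y

lemma continuous_expRemainder : Continuous expRemainder := by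
  unfold expRemainder
  fun_prop

lemma hasDerivAt_exp_neg_mul (u t : ℝ) :
    HasDerivAt (fun t => Real.exp (-(u * t))) (-(u * Real.exp (-(u * t)))) t := by
  have h1 : HasDerivAt (fun t => -(u * t)) (-u) t := by
    simpa using (hasDerivAt_id t).const_mul (-u)
  convert h1.exp using 1
  ring

/-- The derivative of `expRemainder` is `1 - exp(-t)`; the layer-cake formula moves the scale `x`
into the tail, where regular variation applies. -/
lemma integral_expRemainder (P : Measure ℝ) [IsFiniteMeasure P] (hP : ∀ᵐ v ∂P, 0 ≤ v) {x : ℝ}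
    (hx : 0 < x) :
    ∫ v, expRemainder (v / x) ∂P =
      ∫ t in Set.Ioi 0, P.real (Set.Ioi (t * x)) * (1 - Real.exp (-t)) := by
  rw [integral_layercake P (Y := fun v => v / x) (g := fun t => 1 - Real.exp (-t)) ?_
    (by fun_prop) (by fun_prop) ?_ ?_ continuous_expRemainder.measurable]
  · refine setIntegral_congr_fun measurableSet_Ioi fun t _ => ?_
    have : {a : ℝ | t < a / x} = Set.Ioi (t * x) := by
      ext a
      simp [lt_div_iff₀ hx]
    simp only [this]
  · filter_upwards [hP] with v hv
    exact div_nonneg hv hx.le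
  · intro t ht
    simpa using ht.le
  · intro y _
    have hd : ∀ t ∈ Set.uIcc 0 y, HasDerivAt expRemainder (1 - Real.exp (-t)) t := by
      intro t _
      have h1 := hasDerivAt_exp_neg_mul 1 t
      simp only [one_mul] at h1
      have h2 : HasDerivAt expRemainder (-Real.exp (-t) + 1) t :=
        (h1.sub_const 1).add (hasDerivAt_id t)
      rwa [neg_add_eq_sub] at h2
    rw [intervalIntegral.integral_eq_sub_of_hasDerivAt hd
      (Continuous.intervalIntegrable (by fun_prop) _ _)]
    simp [expRemainder]

/-- Layer cake for the scaled overshoot `max (v / x - 1) 0`, which vanishes for `v ≤ x` and gives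
`exp(-u v / x) = exp(-u) exp(-u (v / x - 1))` beyond. -/
lemma setIntegral_exp_Ioi (P : Measure ℝ) [IsFiniteMeasure P] {x u : ℝ} (hx : 0 < x)
    (hu : 0 ≤ u) :
    ∫ v in Set.Ioi x, Real.exp (-(u * (v / x))) ∂P =
      Real.exp (-u) * (P.real (Set.Ioi x) -
        ∫ t in Set.Ioi 0, P.real (Set.Ioi ((1 + t) * x)) * (u * Real.exp (-(u * t)))) := by
  have h1 : ∫ t in Set.Ioi 0, P.real (Set.Ioi ((1 + t) * x)) * (u * Real.exp (-(u * t))) =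
      ∫ v, (1 - Real.exp (-(u * max (v / x - 1) 0))) ∂P := by
    rw [integral_layercake P (Y := fun v => max (v / x - 1) 0)
      (g := fun t => u * Real.exp (-(u * t))) (G := fun y => 1 - Real.exp (-(u * y))) ?_
      (by fun_prop) (by fun_prop) ?_ ?_ (by fun_prop)]
    · refine setIntegral_congr_fun measurableSet_Ioi fun t ht => ?_
      have : {a : ℝ | t < max (a / x - 1) 0} = Set.Ioi ((1 + t) * x) := by
        ext a
        simp only [Set.mem_ofPred_eq, lt_max_iff, Set.mem_Ioi, not_lt.2 (Set.mem_Ioi.1 ht).le, or_false,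
          ← lt_div_iff₀ hx]
        constructor <;> intro h <;> linarith
      simp only [this]
    · exact ae_of_all _ fun v => le_max_right _ _
    · intro t _
      positivity
    · intro y _
      have hd : ∀ t ∈ Set.uIcc 0 y, HasDerivAt (fun t => -Real.exp (-(u * t)))
          (u * Real.exp (-(u * t))) t := by
        intro t _
        have h := (hasDerivAt_exp_neg_mul u t).neg
        rwa [neg_neg] at h
      rw [intervalIntegral.integral_eq_sub_of_hasDerivAt hd
        (Continuous.intervalIntegrable (by fun_prop) _ _)]
      simp
      ring
  have h2 : Integrable (fun v => 1 - Real.exp (-(u * max (v / x - 1) 0))) P := by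
    refine (integrable_const (1 : ℝ)).mono (by fun_prop) (ae_of_all _ fun v => ?_)
    have h3 : Real.exp (-(u * max (v / x - 1) 0)) ≤ 1 := by
      refine Real.exp_le_one_iff.2 ?_
      have := mul_nonneg hu (le_max_right (v / x - 1) 0)
      linarith
    have h4 := Real.exp_pos (-(u * max (v / x - 1) 0))
    rw [Real.norm_eq_abs, norm_one, abs_le]
    constructor <;> linarith
  have h5 : P.real (Set.Ioi x) =
      ∫ v, (Set.Ioi x).indicator (fun _ => (1 : ℝ)) v ∂P :=
    (integral_indicator_one measurableSet_Ioi).symm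
  rw [h1, h5, ← integral_sub ((integrable_indicator_iff measurableSet_Ioi).2
    (integrable_const (1 : ℝ)).integrableOn) h2, ← integral_const_mul,
    ← integral_indicator measurableSet_Ioi]
  refine integral_congr_ae (ae_of_all _ fun v => ?_)
  by_cases hv : x < v
  · have h6 : 0 ≤ v / x - 1 := sub_nonneg.2 ((one_le_div hx).2 hv.le)
    simp only [Set.indicator_apply, Set.mem_Ioi, hv, if_true, max_eq_left h6,
      sub_sub_cancel, ← Real.exp_add]
    ring_nf
  · have h6 : v / x - 1 ≤ 0 := sub_nonpos.2 ((div_le_one hx).2 (not_lt.1 hv))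
    simp [hv, max_eq_right h6]

end LayerCake

/-! ### Asymptotics of Laplace transforms under a regularly varying tail -/

section Limits

variable {ν : ℝ}

/-- The dominating function for Potter's bounds: `1 - exp(-t)` supplies a factor `t` near 0 and 1 at
infinity. -/
lemma integrableOn_ite_rpow {a b : ℝ} (ha : a < 2) (hb : 1 < b) :
    IntegrableOn (fun t : ℝ => if t ≤ 1 then t * t ^ (-a) else t ^ (-b)) (Set.Ioi 0) := by
  rw [← Set.Ioc_union_Ioi_eq_Ioi zero_le_one]
  refine IntegrableOn.union ?_ ?_
  · have h1 : IntegrableOn (fun t : ℝ => t ^ (1 - a)) (Set.Ioc 0 1) :=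
      (intervalIntegrable_iff_integrableOn_Ioc_of_le zero_le_one).1
        (intervalIntegral.intervalIntegrable_rpow' (by linarith))
    refine h1.congr_fun (fun t ht => ?_) measurableSet_Ioc
    simp only [if_pos ht.2]
    rw [sub_eq_add_neg, Real.rpow_add ht.1, Real.rpow_one]
  · have h1 : IntegrableOn (fun t : ℝ => t ^ (-b)) (Set.Ioi 1) :=
      integrableOn_Ioi_rpow_of_lt (by linarith) one_pos
    refine h1.congr_fun (fun t ht => ?_) measurableSet_Ioi
    simp only [if_neg (not_le.2 (Set.mem_Ioi.1 ht))]

lemma one_sub_exp_neg_le (t : ℝ) : 1 - Real.exp (-t) ≤ t := by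
  have := Real.add_one_le_exp (-t)
  linarith

lemma one_sub_exp_neg_nonneg {t : ℝ} (ht : 0 ≤ t) : 0 ≤ 1 - Real.exp (-t) := by
  simpa using ht

lemma one_sub_exp_neg_le_one (t : ℝ) : 1 - Real.exp (-t) ≤ 1 := by
  have := Real.exp_pos (-t)
  linarith

lemma mul_one_sub_exp_le_ite {A C a b t : ℝ} (ht : 0 < t) (hA0 : 0 ≤ A)
    (h1 : t ≤ 1 → A ≤ C * t ^ (-a)) (h2 : 1 ≤ t → A ≤ C * t ^ (-b)) :
    A * (1 - Real.exp (-t)) ≤ C * (if t ≤ 1 then t * t ^ (-a) else t ^ (-b)) := by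
  split_ifs with h
  · calc A * (1 - Real.exp (-t)) ≤ A * t :=
          mul_le_mul_of_nonneg_left (one_sub_exp_neg_le t) hA0
      _ ≤ C * t ^ (-a) * t := mul_le_mul_of_nonneg_right (h1 h) ht.le
      _ = C * (t * t ^ (-a)) := by ring
  · calc A * (1 - Real.exp (-t)) ≤ A * 1 :=
          mul_le_mul_of_nonneg_left (one_sub_exp_neg_le_one t) hA0
      _ ≤ C * t ^ (-b) := by rw [mul_one]; exact h2 (not_le.1 h).le

/-- Integration by parts. The boundary terms vanish at 0 because `ν < 2` and at infinity because `ν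
> 1`; what remains is `-Γ(2-ν)/(1-ν)`. -/
lemma integral_rpow_mul_one_sub_exp (hν₁ : 1 < ν) (hν₂ : ν < 2) :
    ∫ t in Set.Ioi (0 : ℝ), t ^ (-ν) * (1 - Real.exp (-t)) = -Real.Gamma (1 - ν) := by
  have hν0 : 1 - ν ≠ 0 := by linarith
  have hG : Real.Gamma (2 - ν) = (1 - ν) * Real.Gamma (1 - ν) := by
    rw [← Real.Gamma_add_one hν0]
    ring_nf
  have hGi : ∫ t in Set.Ioi (0 : ℝ), Real.exp (-t) * (t ^ (1 - ν) / (1 - ν)) =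
      Real.Gamma (1 - ν) := by
    have h1 : ∀ t : ℝ, Real.exp (-t) * (t ^ (1 - ν) / (1 - ν)) =
        (1 - ν)⁻¹ * (Real.exp (-t) * t ^ (2 - ν - 1)) := by
      intro t
      rw [show 2 - ν - 1 = 1 - ν by ring]
      ring
    simp_rw [h1]
    rw [integral_const_mul, ← Real.Gamma_eq_integral (by linarith), hG, inv_mul_cancel_left₀ hν0]
  have hi1 : IntegrableOn ((fun t : ℝ => 1 - Real.exp (-t)) * fun t => t ^ (-ν)) (Set.Ioi 0) := by
    refine Integrable.mono' (integrableOn_ite_rpow hν₂ hν₁)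
      (by apply Measurable.aestronglyMeasurable; fun_prop) ?_
    refine (ae_restrict_iff' measurableSet_Ioi).2 (ae_of_all _ fun t ht => ?_)
    have ht0 : 0 < t := ht
    have h0 : 0 ≤ t ^ (-ν) * (1 - Real.exp (-t)) :=
      mul_nonneg (Real.rpow_nonneg ht0.le _) (one_sub_exp_neg_nonneg ht0.le)
    rw [Pi.mul_apply, mul_comm, Real.norm_of_nonneg h0]
    simpa using mul_one_sub_exp_le_ite (A := t ^ (-ν)) (C := 1) (a := ν) (b := ν) ht0
      (Real.rpow_nonneg ht0.le _) (fun _ => by rw [one_mul]) (fun _ => by rw [one_mul])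
  have hi2 : IntegrableOn ((fun t : ℝ => Real.exp (-t)) * fun t => t ^ (1 - ν) / (1 - ν))
      (Set.Ioi 0) := by
    have h1 := (Real.GammaIntegral_convergent (show 0 < 2 - ν by linarith)).mul_const (1 - ν)⁻¹
    refine IntegrableOn.congr_fun h1 (fun t _ => ?_) measurableSet_Ioi
    simp only [Pi.mul_apply]
    rw [show 2 - ν - 1 = 1 - ν by ring]
    ring
  have hν' : 0 < ν - 1 := by linarith
  have hnorm : ∀ t : ℝ, 0 < t →
      ‖((fun t : ℝ => 1 - Real.exp (-t)) * fun t => t ^ (1 - ν) / (1 - ν)) t‖ =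
        (1 - Real.exp (-t)) * (t ^ (1 - ν) / (ν - 1)) := by
    intro t ht
    rw [Pi.mul_apply, norm_mul, Real.norm_of_nonneg (one_sub_exp_neg_nonneg ht.le), norm_div,
      Real.norm_of_nonneg (Real.rpow_nonneg ht.le _), Real.norm_eq_abs, abs_sub_comm,
      abs_of_pos hν']
  have hl0 : Tendsto ((fun t : ℝ => 1 - Real.exp (-t)) * fun t => t ^ (1 - ν) / (1 - ν))
      (𝓝[>] 0) (𝓝 0) := by
    have h1 : Tendsto (fun t : ℝ => t ^ (2 - ν) / (ν - 1)) (𝓝[>] 0) (𝓝 0) := by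
      have h2 := ((Real.continuousAt_rpow_const 0 (2 - ν) (Or.inr (by linarith))).tendsto.div_const
        (ν - 1)).mono_left (nhdsWithin_le_nhds (s := Set.Ioi 0))
      rwa [Real.zero_rpow (by linarith), zero_div] at h2
    refine squeeze_zero_norm' ?_ h1
    filter_upwards [self_mem_nhdsWithin] with t ht
    have ht0 : 0 < t := ht
    rw [hnorm t ht0]
    calc (1 - Real.exp (-t)) * (t ^ (1 - ν) / (ν - 1)) ≤ t * (t ^ (1 - ν) / (ν - 1)) :=
          mul_le_mul_of_nonneg_right (one_sub_exp_neg_le t) (by positivity)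
      _ = t ^ (2 - ν) / (ν - 1) := by
          rw [show 2 - ν = 1 + (1 - ν) by ring, Real.rpow_add ht0, Real.rpow_one]
          ring
  have hl1 : Tendsto ((fun t : ℝ => 1 - Real.exp (-t)) * fun t => t ^ (1 - ν) / (1 - ν))
      atTop (𝓝 0) := by
    have h1 : Tendsto (fun t : ℝ => t ^ (1 - ν) / (ν - 1)) atTop (𝓝 0) := by
      have h2 := (tendsto_rpow_neg_atTop hν').div_const (ν - 1)
      rwa [zero_div, neg_sub] at h2
    refine squeeze_zero_norm' ?_ h1
    filter_upwards [eventually_gt_atTop 0] with t ht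
    rw [hnorm t ht]
    exact mul_le_of_le_one_left (by positivity) (one_sub_exp_neg_le_one t)
  have key := integral_Ioi_mul_deriv_eq_deriv_mul (a := (0 : ℝ))
    (u := fun t : ℝ => 1 - Real.exp (-t)) (v := fun t => t ^ (1 - ν) / (1 - ν))
    (u' := fun t => Real.exp (-t)) (v' := fun t => t ^ (-ν))
    (fun t _ => by
      have h1 := (hasDerivAt_exp_neg_mul 1 t).const_sub 1
      simpa using h1)
    (fun t ht => by
      have h1 := (Real.hasDerivAt_rpow_const (p := 1 - ν)
        (Or.inl (Set.mem_Ioi.1 ht).ne')).div_const (1 - ν)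
      rw [mul_div_cancel_left₀ _ hν0, show 1 - ν - 1 = -ν by ring] at h1
      exact h1)
    hi1 hi2 hl0 hl1
  simp_rw [mul_comm (_ ^ (-ν))]
  rw [key, hGi]
  ring

/-- Second-order expansion at the origin of the Laplace transform of a law with regularly varying
tail of index between one and two. -/
lemma tendsto_integral_expRemainder (hν₁ : 1 < ν) (hν₂ : ν < 2) {P : Measure ℝ}
    [IsProbabilityMeasure P] (hP : ∀ᵐ v ∂P, 0 ≤ v)
    (hF : RegularlyVarying (fun x => P.real (Set.Ioi x)) (-ν)) :
    Tendsto (fun x => (∫ v, expRemainder (v / x) ∂P) / P.real (Set.Ioi x)) atTop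
      (𝓝 (-Real.Gamma (1 - ν))) := by
  set f : ℝ → ℝ := fun x => P.real (Set.Ioi x) with hf
  have hanti : Antitone f := fun x y hxy => measureReal_mono (Set.Ioi_subset_Ioi hxy)
  have h0 : ∀ x, 0 ≤ f x := fun x => measureReal_nonneg
  have h1 : ∀ x, f x ≤ 1 := fun x => measureReal_le_one
  have hpos := hF.pos_of_antitone hanti h0
  -- Half the distance from `ν` to the ends of `(1, 2)`, so that the exponents `ν ± δ` of Potter's
  -- bounds still give an integrable majorant.
  obtain ⟨δ, hδ, hδ1, hδ2⟩ : ∃ δ : ℝ, 0 < δ ∧ ν + δ < 2 ∧ 1 < ν - δ := by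
    refine ⟨min (2 - ν) (ν - 1) / 2, ?_, ?_, ?_⟩
    · have := lt_min (sub_pos.2 hν₂) (sub_pos.2 hν₁)
      linarith
    · have := min_le_left (2 - ν) (ν - 1)
      linarith
    · have := min_le_right (2 - ν) (ν - 1)
      linarith
  obtain ⟨C₁, x₁, hC₁, -, hb₁⟩ := hF.potter_origin hanti h0 h1 hδ (by linarith)
  obtain ⟨C₂, x₂, hC₂, -, hb₂⟩ := hF.potter_upper hanti h0 hδ (by linarith)
  rw [← integral_rpow_mul_one_sub_exp hν₁ hν₂]
  have hmeas : ∀ x : ℝ, 0 < x → Measurable fun t => f (t * x) / f x * (1 - Real.exp (-t)) := by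
    intro x hx
    have : Antitone fun t => f (t * x) := fun s t hst => hanti (by gcongr)
    exact (this.measurable.div_const _).mul (by fun_prop)
  have hlim : Tendsto (fun x => ∫ t in Set.Ioi 0, f (t * x) / f x * (1 - Real.exp (-t))) atTop
      (𝓝 (∫ t in Set.Ioi (0 : ℝ), t ^ (-ν) * (1 - Real.exp (-t)))) := by
    refine tendsto_integral_filter_of_dominated_convergence
      (fun t => max C₁ C₂ * (if t ≤ 1 then t * t ^ (-(ν + δ)) else t ^ (-(ν - δ)))) ?_ ?_
      ((integrableOn_ite_rpow hδ1 hδ2).const_mul _) ?_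
    · filter_upwards [eventually_gt_atTop 0] with x hx
      exact (hmeas x hx).aestronglyMeasurable
    · filter_upwards [eventually_ge_atTop x₁, eventually_ge_atTop x₂] with x hx₁ hx₂
      refine (ae_restrict_iff' measurableSet_Ioi).2 (ae_of_all _ fun t ht => ?_)
      have ht0 : 0 < t := ht
      have hA : 0 ≤ f (t * x) / f x := div_nonneg (h0 _) (h0 _)
      rw [Real.norm_of_nonneg (mul_nonneg hA (one_sub_exp_neg_nonneg ht0.le))]
      refine mul_one_sub_exp_le_ite ht0 hA (fun h => ?_) (fun h => ?_)
      · rw [div_le_iff₀ (hpos x)]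
        refine (hb₁ x hx₁ t ht0 h).trans ?_
        gcongr
        exact le_max_left _ _
      · rw [div_le_iff₀ (hpos x)]
        refine (hb₂ x hx₂ t h).trans ?_
        gcongr
        exact le_max_right _ _
    · refine (ae_restrict_iff' measurableSet_Ioi).2 (ae_of_all _ fun t ht => ?_)
      exact (hF t ht).mul_const _
  refine hlim.congr' ?_
  filter_upwards [eventually_gt_atTop 0] with x hx
  rw [integral_expRemainder P hP hx, ← integral_div]
  refine integral_congr_ae (ae_of_all _ fun t => ?_)
  simp only [hf]
  ring

lemma measureReal_paretoMeasure_Ioi (hν : 0 < ν) {x : ℝ} (hx : 1 ≤ x) :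
    (paretoMeasure 1 ν).real (Set.Ioi x) = x ^ (-ν) := by
  have hx0 : 0 < x := by linarith
  have e1 : paretoMeasure 1 ν (Set.Ioi x) =
      ∫⁻ t in Set.Ioi x, ENNReal.ofReal (ν * t ^ (-(ν + 1))) := by
    rw [paretoMeasure, withDensity_apply _ measurableSet_Ioi]
    refine setLIntegral_congr_fun measurableSet_Ioi fun t ht => ?_
    rw [paretoPDF_of_le (hx.trans (Set.mem_Ioi.1 ht).le), Real.one_rpow, mul_one]
  rw [measureReal_def, e1, ← integral_eq_lintegral_of_nonneg_ae, integral_const_mul,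
    integral_Ioi_rpow_of_lt (by linarith) hx0]
  · rw [show -(ν + 1) + 1 = -ν by ring]
    field_simp
  · refine (ae_restrict_iff' measurableSet_Ioi).2 (ae_of_all _ fun t ht => ?_)
    have : 0 < t := hx0.trans ht
    simp only [Pi.zero_apply]
    positivity
  · exact Measurable.aestronglyMeasurable (by fun_prop)

lemma ae_paretoMeasure_one_lt (hν : 0 < ν) : ∀ᵐ t ∂(paretoMeasure 1 ν), 1 < t := by
  have := isProbabilityMeasure_paretoMeasure one_pos hν
  have h1 : paretoMeasure 1 ν (Set.Ioi 1) = 1 := by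
    rw [← ENNReal.toReal_eq_one_iff, ← measureReal_def, measureReal_paretoMeasure_Ioi hν le_rfl,
      Real.one_rpow]
  exact (mem_ae_iff_prob_eq_one measurableSet_Ioi).2 h1

/-- The scaled overshoot over a high level of a law with regularly varying tail is asymptotically
Pareto, in the sense of Laplace transforms. -/
lemma tendsto_setIntegral_exp_Ioi (hν : 0 < ν) {P : Measure ℝ} [IsProbabilityMeasure P]
    (hF : RegularlyVarying (fun x => P.real (Set.Ioi x)) (-ν)) {u : ℝ} (hu : 0 < u) :
    Tendsto (fun x => (∫ v in Set.Ioi x, Real.exp (-(u * (v / x))) ∂P) / P.real (Set.Ioi x)) atTop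
      (𝓝 (∫ t, Real.exp (-(u * t)) ∂(paretoMeasure 1 ν))) := by
  have := isProbabilityMeasure_paretoMeasure one_pos hν
  set f : ℝ → ℝ := fun x => P.real (Set.Ioi x) with hf
  have hanti : Antitone f := fun x y hxy => measureReal_mono (Set.Ioi_subset_Ioi hxy)
  have h0 : ∀ x, 0 ≤ f x := fun x => measureReal_nonneg
  have hpos := hF.pos_of_antitone hanti h0
  -- The overshoot formula for the Pareto law itself at level 1; it remains to compare tail ratios,
  -- which are at most 1 by monotonicity.
  have e1 : ∫ t, Real.exp (-(u * t)) ∂(paretoMeasure 1 ν) =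
      Real.exp (-u) * (1 - ∫ t in Set.Ioi (0 : ℝ), (1 + t) ^ (-ν) * (u * Real.exp (-(u * t)))) := by
    have h1 := setIntegral_exp_Ioi (paretoMeasure 1 ν) one_pos hu.le
    have hr : (paretoMeasure 1 ν).restrict (Set.Ioi 1) = paretoMeasure 1 ν :=
      Measure.restrict_eq_self_of_ae_mem (ae_paretoMeasure_one_lt hν)
    rw [hr, measureReal_paretoMeasure_Ioi hν le_rfl, Real.one_rpow] at h1
    simp only [div_one, mul_one] at h1
    rw [h1]
    congr 2
    refine setIntegral_congr_fun measurableSet_Ioi fun t ht => ?_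
    rw [measureReal_paretoMeasure_Ioi hν (by linarith [Set.mem_Ioi.1 ht])]
  have hi : IntegrableOn (fun t => u * Real.exp (-(u * t))) (Set.Ioi 0) := by
    have h1 := exp_neg_integrableOn_Ioi 0 hu
    simp only [neg_mul] at h1
    exact h1.const_mul u
  have hlim : Tendsto (fun x => ∫ t in Set.Ioi 0, f ((1 + t) * x) / f x *
      (u * Real.exp (-(u * t)))) atTop
      (𝓝 (∫ t in Set.Ioi (0 : ℝ), (1 + t) ^ (-ν) * (u * Real.exp (-(u * t))))) := by
    refine tendsto_integral_filter_of_dominated_convergence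
      (fun t => u * Real.exp (-(u * t))) ?_ ?_ hi ?_
    · filter_upwards [eventually_gt_atTop 0] with x hx
      have : Antitone fun t => f ((1 + t) * x) := fun s t hst => hanti (by gcongr)
      exact ((this.measurable.div_const _).mul (by fun_prop)).aestronglyMeasurable
    · filter_upwards [eventually_gt_atTop 0] with x hx
      refine (ae_restrict_iff' measurableSet_Ioi).2 (ae_of_all _ fun t ht => ?_)
      have ht0 : 0 < t := ht
      have hA : 0 ≤ f ((1 + t) * x) / f x := div_nonneg (h0 _) (h0 _)
      rw [Real.norm_of_nonneg (mul_nonneg hA (by positivity))]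
      refine mul_le_of_le_one_left (by positivity) ((div_le_one (hpos x)).2 (hanti ?_))
      nlinarith
    · refine (ae_restrict_iff' measurableSet_Ioi).2 (ae_of_all _ fun t ht => ?_)
      have ht0 : 0 < t := ht
      exact (hF (1 + t) (by linarith)).mul_const _
  rw [e1]
  refine ((hlim.const_sub 1).const_mul (Real.exp (-u))).congr' ?_
  filter_upwards [eventually_gt_atTop 0] with x hx
  rw [setIntegral_exp_Ioi P hx hu.le, mul_div_assoc, sub_div, div_self (hpos x).ne', ← integral_div]
  congr 2
  refine integral_congr_ae (ae_of_all _ fun t => ?_)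
  simp only [hf]
  ring

end Limits

/-! ### The limiting equation -/

section Kappa

variable {ν lam γ : ℝ}

/-- Laplace transform of the Pareto law with scale one. -/
def paretoLaplace (ν u : ℝ) : ℝ := ∫ t, Real.exp (-(u * t)) ∂(paretoMeasure 1 ν)

/-- Difference of the two sides of the limiting equation, multiplied by `-Γ(1-ν)`, with
`b = γ y^(ν-1)`. -/
def kappaGap (ν lam b κ : ℝ) : ℝ :=
  -Real.Gamma (1 - ν) * (lam * κ) ^ ν + κ * b - paretoLaplace ν (lam * κ)

lemma neg_Gamma_pos (hν₁ : 1 < ν) (hν₂ : ν < 2) : 0 < -Real.Gamma (1 - ν) := by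
  have h1 : Real.Gamma (2 - ν) = (1 - ν) * Real.Gamma (1 - ν) := by
    rw [← Real.Gamma_add_one (by linarith)]
    ring_nf
  have h2 : 0 < Real.Gamma (2 - ν) := Real.Gamma_pos_of_pos (by linarith)
  rw [h1] at h2
  nlinarith

lemma exp_neg_mul_le_one_ae (hν : 0 < ν) {u : ℝ} (hu : 0 ≤ u) :
    ∀ᵐ t ∂(paretoMeasure 1 ν), ‖Real.exp (-(u * t))‖ ≤ 1 := by
  filter_upwards [ae_paretoMeasure_one_lt hν] with t ht
  rw [Real.norm_eq_abs, Real.abs_exp]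
  refine Real.exp_le_one_iff.2 ?_
  have := mul_nonneg hu (zero_le_one.trans ht.le)
  linarith

lemma integrable_exp_pareto (hν : 0 < ν) {u : ℝ} (hu : 0 ≤ u) :
    Integrable (fun t => Real.exp (-(u * t))) (paretoMeasure 1 ν) := by
  have := isProbabilityMeasure_paretoMeasure one_pos hν
  refine (integrable_const (1 : ℝ)).mono' (by fun_prop) ?_
  exact exp_neg_mul_le_one_ae hν hu

lemma paretoLaplace_zero (hν : 0 < ν) : paretoLaplace ν 0 = 1 := by
  have := isProbabilityMeasure_paretoMeasure one_pos hν
  simp [paretoLaplace]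

lemma paretoLaplace_anti (hν : 0 < ν) {u u' : ℝ} (hu : 0 ≤ u) (huu' : u ≤ u') :
    paretoLaplace ν u' ≤ paretoLaplace ν u := by
  refine integral_mono_ae (integrable_exp_pareto hν (hu.trans huu'))
    (integrable_exp_pareto hν hu) ?_
  filter_upwards [ae_paretoMeasure_one_lt hν] with t ht
  have : 0 < t := by linarith
  exact Real.exp_le_exp.2 (by nlinarith)

lemma paretoLaplace_le_one (hν : 0 < ν) {u : ℝ} (hu : 0 ≤ u) : paretoLaplace ν u ≤ 1 :=
  (paretoLaplace_anti hν le_rfl hu).trans_eq (paretoLaplace_zero hν)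

lemma continuousOn_paretoLaplace (hν : 0 < ν) : ContinuousOn (paretoLaplace ν) (Set.Ici 0) := by
  have := isProbabilityMeasure_paretoMeasure one_pos hν
  refine continuousOn_of_dominated (bound := fun _ => 1) (fun u _ => by fun_prop)
    (fun u hu => exp_neg_mul_le_one_ae hν hu) (integrable_const _) ?_
  exact ae_of_all _ fun t => by fun_prop

lemma kappaEquation_iff (hν₁ : 1 < ν) (hν₂ : ν < 2) (y κ : ℝ) :
    KappaEquation ν lam γ y κ ↔ kappaGap ν lam (γ * y ^ (ν - 1)) κ = 0 := by
  have hg := neg_Gamma_pos hν₁ hν₂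
  have hg' : Real.Gamma (1 - ν) ≠ 0 := by linarith
  rw [KappaEquation, kappaGap]
  have h1 : ∫ t, Real.exp (-(lam * κ * t)) ∂(paretoMeasure 1 ν) = paretoLaplace ν (lam * κ) := rfl
  rw [h1]
  constructor <;> intro h
  · rw [← h]
    field_simp
    ring
  · field_simp
    linarith

/-- The power term increases strictly, the linear term does not decrease, and the subtracted
transform does not increase. -/
lemma kappaGap_strictMono (hν₁ : 1 < ν) (hν₂ : ν < 2) (hlam : 0 < lam) {b : ℝ} (hb : 0 ≤ b)
    {κ κ' : ℝ} (hκ : 0 ≤ κ) (hκκ' : κ < κ') : kappaGap ν lam b κ < kappaGap ν lam b κ' := by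
  have hg := neg_Gamma_pos hν₁ hν₂
  have h1 : (lam * κ) ^ ν < (lam * κ') ^ ν :=
    Real.rpow_lt_rpow (by positivity) (by gcongr) (by linarith)
  have h2 : paretoLaplace ν (lam * κ') ≤ paretoLaplace ν (lam * κ) :=
    paretoLaplace_anti (by linarith) (by positivity) (by gcongr)
  have h3 : κ * b ≤ κ' * b := by gcongr
  have h4 := mul_lt_mul_of_pos_left h1 hg
  rw [kappaGap, kappaGap]
  linarith

lemma lt_of_kappaGap_lt (hν₁ : 1 < ν) (hν₂ : ν < 2) (hlam : 0 < lam) {b : ℝ} (hb : 0 ≤ b)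
    {κ κ' : ℝ} (hκ' : 0 ≤ κ') (h : kappaGap ν lam b κ < kappaGap ν lam b κ') : κ < κ' := by
  by_contra! hle
  rcases hle.eq_or_lt with rfl | hlt
  · exact lt_irrefl _ h
  · exact absurd h (kappaGap_strictMono hν₁ hν₂ hlam hb hκ' hlt).not_gt

/-- The gap is `-1` at 0, and at the claimed bound the power term equals 1, which dominates the
transform. The intermediate value theorem yields root and bound together. -/
lemma exists_kappaGap_eq_zero (hν₁ : 1 < ν) (hν₂ : ν < 2) (hlam : 0 < lam) {b : ℝ}
    (hb : 0 ≤ b) : ∃ κ, 0 < κ ∧ kappaGap ν lam b κ = 0 ∧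
      κ ≤ 1 / lam * (-1 / Real.Gamma (1 - ν)) ^ (1 / ν) := by
  have hg := neg_Gamma_pos hν₁ hν₂
  have hν0 : 0 < ν := by linarith
  have hc : -1 / Real.Gamma (1 - ν) = (-Real.Gamma (1 - ν))⁻¹ := by
    rw [inv_neg, neg_div, one_div]
  set B := 1 / lam * (-1 / Real.Gamma (1 - ν)) ^ (1 / ν) with hB
  have hB0 : 0 < B := by rw [hB, hc]; positivity
  have hBν : -Real.Gamma (1 - ν) * (lam * B) ^ ν = 1 := by
    rw [hB, ← mul_assoc, mul_one_div_cancel hlam.ne', one_mul, hc, ← Real.rpow_mul (by positivity),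
      one_div_mul_cancel hν0.ne', Real.rpow_one, mul_inv_cancel₀ hg.ne']
  have hcont : ContinuousOn (kappaGap ν lam b) (Set.Icc 0 B) := by
    have h1 : ContinuousOn (fun κ => paretoLaplace ν (lam * κ)) (Set.Icc 0 B) :=
      (continuousOn_paretoLaplace hν0).comp (by fun_prop) fun κ hκ => mul_nonneg hlam.le hκ.1
    have h2 : Continuous fun κ : ℝ => (lam * κ) ^ ν :=
      (Real.continuous_rpow_const hν0.le).comp (by fun_prop)
    exact ((h2.const_mul _).add (by fun_prop)).continuousOn.sub h1
  have h0 : kappaGap ν lam b 0 = -1 := by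
    rw [kappaGap, mul_zero, Real.zero_rpow hν0.ne', paretoLaplace_zero hν0]
    ring
  have h1 : 0 ≤ kappaGap ν lam b B := by
    rw [kappaGap, hBν]
    have := paretoLaplace_le_one hν0 (mul_nonneg hlam.le hB0.le)
    have := mul_nonneg hB0.le hb
    linarith
  obtain ⟨κ, hκ, hκ0⟩ := intermediate_value_Icc hB0.le hcont
    (show (0 : ℝ) ∈ Set.Icc _ _ from ⟨by rw [h0]; norm_num, h1⟩)
  refine ⟨κ, hκ.1.lt_of_ne ?_, hκ0, hκ.2⟩
  rintro rfl
  rw [h0] at hκ0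
  norm_num at hκ0

section

variable {κ : ℝ → ℝ}

/-- By monotonicity, comparing the root with `a ≥ 0` amounts to the sign of the gap at `a`, which is
continuous in `y`. -/
lemma continuousOn_of_kappaGap (hν₁ : 1 < ν) (hν₂ : ν < 2) (hlam : 0 < lam) (hγ : 0 ≤ γ)
    (hpos : ∀ y, 0 < y → 0 < κ y)
    (hroot : ∀ y, 0 < y → kappaGap ν lam (γ * y ^ (ν - 1)) (κ y) = 0) :
    ContinuousOn κ (Set.Ioi 0) := by
  intro y hy
  have hy0 : 0 < y := hy
  refine ContinuousAt.continuousWithinAt ?_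
  have hcont : ∀ a, Tendsto (fun z => kappaGap ν lam (γ * z ^ (ν - 1)) a) (𝓝 y)
      (𝓝 (kappaGap ν lam (γ * y ^ (ν - 1)) a)) := by
    intro a
    have h1 := (Real.continuousAt_rpow_const y (ν - 1) (Or.inl hy0.ne')).tendsto
    exact (((h1.const_mul γ).const_mul a).const_add _).sub_const _
  have hb : ∀ z, 0 < z → 0 ≤ γ * z ^ (ν - 1) := fun z hz => by positivity
  refine tendsto_order.2 ⟨fun a ha => ?_, fun a ha => ?_⟩
  · rcases lt_or_ge a 0 with h0 | h0
    · filter_upwards [lt_mem_nhds hy0] with z hz using h0.trans (hpos z hz)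
    · have h1 := kappaGap_strictMono hν₁ hν₂ hlam (hb y hy0) h0 ha
      rw [hroot y hy0] at h1
      filter_upwards [(hcont a).eventually_lt_const h1, lt_mem_nhds hy0] with z hz hz0
      rw [← hroot z hz0] at hz
      exact lt_of_kappaGap_lt hν₁ hν₂ hlam (hb z hz0) (hpos z hz0).le hz
  · have h1 := kappaGap_strictMono hν₁ hν₂ hlam (hb y hy0) (hpos y hy0).le ha
    rw [hroot y hy0] at h1
    filter_upwards [(hcont a).eventually_const_lt h1, lt_mem_nhds hy0] with z hz hz0
    rw [← hroot z hz0] at hz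
    exact lt_of_kappaGap_lt hν₁ hν₂ hlam (hb z hz0) ((hpos y hy0).trans ha).le hz

/-- The equation bounds `κ y` by `y^(1-ν) / γ`, so `κ` tends to 0. Then the power term vanishes, the
transform tends to 1, and `κ y * γ y^(ν-1)` tends to 1. -/
lemma regularlyVarying_of_kappaGap (hν₁ : 1 < ν) (hν₂ : ν < 2) (hlam : 0 < lam) (hγ : 0 < γ)
    (hpos : ∀ y, 0 < y → 0 < κ y)
    (hroot : ∀ y, 0 < y → kappaGap ν lam (γ * y ^ (ν - 1)) (κ y) = 0) :
    RegularlyVarying κ (1 - ν) := by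
  have hg := neg_Gamma_pos hν₁ hν₂
  have hν0 : 0 < ν := by linarith
  have hle : ∀ y, 0 < y → κ y ≤ γ⁻¹ * y ^ (-(ν - 1)) := by
    intro y hy
    have h1 := hroot y hy
    rw [kappaGap] at h1
    have h2 := paretoLaplace_le_one hν0 (mul_nonneg hlam.le (hpos y hy).le)
    have h3 : 0 ≤ -Real.Gamma (1 - ν) * (lam * κ y) ^ ν :=
      mul_nonneg hg.le (Real.rpow_nonneg (mul_nonneg hlam.le (hpos y hy).le) _)
    have h4 : 0 < γ * y ^ (ν - 1) := by positivity
    rw [Real.rpow_neg hy.le, ← mul_inv, ← one_div, le_div_iff₀ h4]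
    linarith
  have h0 : Tendsto κ atTop (𝓝 0) := by
    have h1 := (tendsto_rpow_neg_atTop (sub_pos.2 hν₁)).const_mul γ⁻¹
    rw [mul_zero] at h1
    refine squeeze_zero' ?_ ?_ h1
    · filter_upwards [eventually_gt_atTop 0] with y hy using (hpos y hy).le
    · filter_upwards [eventually_gt_atTop 0] with y hy using hle y hy
  have h1 : Tendsto (fun y => lam * κ y) atTop (𝓝[Set.Ici 0] 0) := by
    refine tendsto_nhdsWithin_iff.2 ⟨by simpa using h0.const_mul lam, ?_⟩
    filter_upwards [eventually_gt_atTop 0] with y hy using mul_nonneg hlam.le (hpos y hy).le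
  have h2 : Tendsto (fun y => κ y * (γ * y ^ (ν - 1))) atTop (𝓝 1) := by
    have h3 := (continuousOn_paretoLaplace hν0 0 Set.self_mem_Ici).tendsto.comp h1
    have h4 := ((Real.continuous_rpow_const hν0.le).tendsto 0).comp
      (h1.mono_right nhdsWithin_le_nhds)
    rw [Real.zero_rpow hν0.ne'] at h4
    rw [paretoLaplace_zero hν0] at h3
    have h5 := h3.sub (h4.const_mul (-Real.Gamma (1 - ν)))
    rw [mul_zero, sub_zero] at h5
    refine h5.congr' ?_
    filter_upwards [eventually_gt_atTop 0] with y hy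
    have h6 := hroot y hy
    rw [kappaGap] at h6
    simp only [Function.comp_apply]
    linarith
  intro c hc
  have h3 : Tendsto (fun y : ℝ => c * y) atTop atTop := tendsto_id.const_mul_atTop hc
  have h4 := ((h2.comp h3).div h2 one_ne_zero).mul_const (c ^ (1 - ν))
  rw [div_one, one_mul] at h4
  refine h4.congr' ?_
  filter_upwards [eventually_gt_atTop 0] with y hy
  have hκ := hpos y hy
  have hyp : 0 < y ^ (ν - 1) := by positivity
  have hcp : 0 < c ^ (ν - 1) := by positivity
  simp only [Function.comp_apply, Pi.div_apply]
  rw [Real.mul_rpow hc.le hy.le, show 1 - ν = -(ν - 1) by ring, Real.rpow_neg hc.le]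
  field_simp

end

end Kappa

/-! ### Convergence of the rescaled tail -/

section Convergence

variable {P : Measure ℝ} {ν lam γ r x : ℝ}

/-- The fixed-point equation for `P(M > x) = u / (r x)`, where `M` is the largest job of a busy
period, reads `fixedPointGap P r x u = 0`. -/
def fixedPointGap (P : Measure ℝ) (r x u : ℝ) : ℝ :=
  ∫ v, expRemainder (u * (v / x)) ∂P + u / (r * x) * (1 - r * ∫ v, v ∂P) -
    ∫ v in Set.Ioi x, Real.exp (-(u * (v / x))) ∂P

lemma expRemainder_mono {a b : ℝ} (ha : 0 ≤ a) (hab : a ≤ b) :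
    expRemainder a ≤ expRemainder b := by
  have h1 : Real.exp (-b) = Real.exp (-a) * Real.exp (-(b - a)) := by
    rw [← Real.exp_add]
    ring_nf
  have h2 := one_sub_exp_neg_le (b - a)
  have h3 := one_sub_exp_neg_nonneg (sub_nonneg.2 hab)
  have h4 : Real.exp (-a) ≤ 1 := by simpa using ha
  have h5 : Real.exp (-a) * (1 - Real.exp (-(b - a))) ≤ 1 * (1 - Real.exp (-(b - a))) :=
    mul_le_mul_of_nonneg_right h4 h3
  rw [expRemainder, expRemainder, h1]
  linarith

lemma ae_norm_exp_le_one (hP : ∀ᵐ v ∂P, 0 ≤ v) {θ : ℝ} (hθ : 0 ≤ θ) :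
    ∀ᵐ v ∂P, ‖Real.exp (-(θ * v))‖ ≤ 1 := by
  filter_upwards [hP] with v hv
  rw [Real.norm_eq_abs, Real.abs_exp]
  refine Real.exp_le_one_iff.2 ?_
  have := mul_nonneg hθ hv
  linarith

lemma integrable_exp_neg_mul [IsFiniteMeasure P] (hP : ∀ᵐ v ∂P, 0 ≤ v) {θ : ℝ} (hθ : 0 ≤ θ) :
    Integrable (fun v => Real.exp (-(θ * v))) P :=
  (integrable_const (1 : ℝ)).mono' (by fun_prop) (ae_norm_exp_le_one hP hθ)

lemma integrable_exp_neg_mul_div [IsFiniteMeasure P] (hP : ∀ᵐ v ∂P, 0 ≤ v) (hx : 0 < x) {u : ℝ}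
    (hu : 0 ≤ u) : Integrable (fun v => Real.exp (-(u * (v / x)))) P := by
  simpa only [mul_div_right_comm, mul_div_assoc'] using
    integrable_exp_neg_mul hP (div_nonneg hu hx.le)

lemma integrable_expRemainder [IsFiniteMeasure P] (hP : ∀ᵐ v ∂P, 0 ≤ v)
    (hint : Integrable (fun v => v) P) (hx : 0 < x) {u : ℝ} (hu : 0 ≤ u) :
    Integrable (fun v => expRemainder (u * (v / x))) P :=
  ((integrable_exp_neg_mul_div hP hx hu).sub (integrable_const 1)).add
    ((hint.div_const x).const_mul u)

/-- Load at most 1 makes the slack term nondecreasing; the other two terms are monotone pointwise.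
-/
lemma fixedPointGap_mono [IsFiniteMeasure P] (hP : ∀ᵐ v ∂P, 0 ≤ v)
    (hint : Integrable (fun v => v) P) (hload : r * ∫ v, v ∂P ≤ 1) (hr : 0 < r) (hx : 0 < x)
    {u u' : ℝ} (hu : 0 ≤ u) (huu' : u ≤ u') : fixedPointGap P r x u ≤ fixedPointGap P r x u' := by
  have hu' := hu.trans huu'
  have h1 : ∫ v, expRemainder (u * (v / x)) ∂P ≤ ∫ v, expRemainder (u' * (v / x)) ∂P := by
    refine integral_mono_ae (integrable_expRemainder hP hint hx hu)
      (integrable_expRemainder hP hint hx hu') ?_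
    filter_upwards [hP] with v hv
    have : 0 ≤ v / x := div_nonneg hv hx.le
    exact expRemainder_mono (mul_nonneg hu this) (by gcongr)
  have h2 : ∫ v in Set.Ioi x, Real.exp (-(u' * (v / x))) ∂P ≤
      ∫ v in Set.Ioi x, Real.exp (-(u * (v / x))) ∂P := by
    refine integral_mono_ae (integrable_exp_neg_mul_div hP hx hu').integrableOn
      (integrable_exp_neg_mul_div hP hx hu).integrableOn ?_
    filter_upwards [ae_restrict_of_ae hP] with v hv
    have : 0 ≤ v / x := div_nonneg hv hx.le
    exact Real.exp_le_exp.2 (neg_le_neg (by gcongr))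
  have h3 : u / (r * x) * (1 - r * ∫ v, v ∂P) ≤ u' / (r * x) * (1 - r * ∫ v, v ∂P) :=
    mul_le_mul_of_nonneg_right (by gcongr) (by linarith)
  rw [fixedPointGap, fixedPointGap]
  linarith

/-- The linear term of the remainder cancels the mean in the slack term, and the integral above `x`
is removed from the full transform. -/
lemma fixedPointGap_eq [IsProbabilityMeasure P] (hP : ∀ᵐ v ∂P, 0 ≤ v)
    (hint : Integrable (fun v => v) P) (hr : 0 < r) (hx : 0 < x) {m : ℝ} (hm : 0 ≤ m) :
    fixedPointGap P r x (r * m * x) =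
      ∫ v in Set.Iic x, Real.exp (-(r * m * v)) ∂P - (1 - m) := by
  have hrm : 0 ≤ r * m := mul_nonneg hr.le hm
  have he := integrable_exp_neg_mul hP hrm
  have h1 : ∀ v, r * m * x * (v / x) = r * m * v := fun v => by field_simp
  have h2 : ∫ v, expRemainder (r * m * v) ∂P =
      ∫ v, Real.exp (-(r * m * v)) ∂P - 1 + r * m * ∫ v, v ∂P := by
    have h3 : Integrable (fun v => Real.exp (-(r * m * v)) - 1) P := he.sub (integrable_const 1)
    simp only [expRemainder]
    rw [integral_add h3 (hint.const_mul _), integral_sub he (integrable_const 1),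
      integral_const_mul]
    simp
  have h3 := integral_add_compl (measurableSet_Iic (a := x)) he
  rw [Set.compl_Iic] at h3
  have h4 : r * m * x / (r * x) = m := by field_simp
  rw [fixedPointGap]
  simp_rw [h1]
  rw [h2, h4, ← h3]
  ring

/-- The difference of the two sides is positive at `q = 0` and negative at `q = 1`. Any root in
between will do, since `measure_largestJob_le` identifies it with the probability. -/
lemma exists_fixedPoint [IsProbabilityMeasure P] (hP : ∀ᵐ v ∂P, 0 ≤ v)
    (hint : Integrable (fun v => v) P) (hr : 0 < r) (hx : 0 < x)
    (hF0 : 0 < P.real (Set.Ioi x)) (hF1 : P.real (Set.Ioi x) < 1) :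
    ∃ q, 0 < q ∧ q < 1 ∧ laplaceOn P (Set.Iic x) (r * (1 - q)) = ENNReal.ofReal q ∧
      fixedPointGap P r x (r * (1 - q) * x) = 0 := by
  have hcompl : P.real (Set.Iic x) = 1 - P.real (Set.Ioi x) := by
    rw [← Set.compl_Ioi, probReal_compl_eq_one_sub measurableSet_Ioi]
  set ψ : ℝ → ℝ := fun q => ∫ v in Set.Iic x, Real.exp (-(r * (1 - q) * v)) ∂P - q with hψ
  have hcont : ContinuousOn ψ (Set.Icc 0 1) := by
    refine ContinuousOn.sub (continuousOn_of_dominated (bound := fun _ => 1)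
      (fun q _ => by fun_prop) (fun q hq => ?_) (integrable_const _) ?_) continuousOn_id
    · exact ae_norm_exp_le_one (ae_restrict_of_ae hP) (mul_nonneg hr.le (sub_nonneg.2 hq.2))
    · exact ae_of_all _ fun v => by fun_prop
  have hψ1 : ψ 1 < 0 := by
    simp only [hψ, sub_self, mul_zero, zero_mul, neg_zero, Real.exp_zero, setIntegral_const,
      smul_eq_mul, mul_one]
    linarith
  have hψ0 : 0 < ψ 0 := by
    have hi : IntegrableOn (fun v => Real.exp (-(r * v))) (Set.Iic x) P :=
      (integrable_exp_neg_mul hP hr.le).integrableOn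
    have h1 : ∫ v in Set.Iic x, Real.exp (-(r * x)) ∂P ≤
        ∫ v in Set.Iic x, Real.exp (-(r * v)) ∂P := by
      refine setIntegral_mono_on (integrable_const _) hi measurableSet_Iic fun v hv => ?_
      exact Real.exp_le_exp.2 (neg_le_neg (mul_le_mul_of_nonneg_left hv hr.le))
    rw [setIntegral_const, smul_eq_mul] at h1
    have h2 : 0 < P.real (Set.Iic x) * Real.exp (-(r * x)) :=
      mul_pos (by linarith) (Real.exp_pos _)
    simp only [hψ, sub_zero, mul_one]
    linarith
  obtain ⟨q, hq, hq0⟩ := intermediate_value_Ioo' zero_le_one hcont ⟨hψ1, hψ0⟩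
  have hq' : ∫ v in Set.Iic x, Real.exp (-(r * (1 - q) * v)) ∂P = q := sub_eq_zero.1 hq0
  have hm : 0 ≤ 1 - q := (sub_pos.2 hq.2).le
  refine ⟨q, hq.1, hq.2, ?_, ?_⟩
  · rw [laplaceOn, ← ofReal_integral_eq_lintegral_ofReal
      (integrable_exp_neg_mul hP (mul_nonneg hr.le hm)).integrableOn
      (ae_of_all _ fun v => (Real.exp_pos _).le), hq']
  · rw [fixedPointGap_eq hP hint hr hx hm, hq']
    ring

lemma tendsto_fixedPointGap [IsProbabilityMeasure P] (hν₁ : 1 < ν) (hν₂ : ν < 2)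
    (hP : ∀ᵐ v ∂P, 0 ≤ v) (hF : RegularlyVarying (fun x => P.real (Set.Ioi x)) (-ν))
    {rate : ℕ → ℝ} (hlam : 0 < lam) (hrate : Tendsto rate atTop (𝓝 lam))
    (hheavy : Tendsto (fun n : ℕ => (1 - rate n * ∫ v, v ∂P) / (n * P.real (Set.Ioi (n : ℝ))))
      atTop (𝓝 γ)) {y u : ℝ} (hy : 0 < y) (hu : 0 < u) :
    Tendsto (fun n : ℕ => fixedPointGap P (rate n) (n * y) u / P.real (Set.Ioi (n * y))) atTop
      (𝓝 (kappaGap ν lam (γ * y ^ (ν - 1)) (u / lam))) := by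
  set f : ℝ → ℝ := fun x => P.real (Set.Ioi x) with hf
  have hpos : ∀ x, 0 < f x := hF.pos_of_antitone
    (fun x y hxy => measureReal_mono (Set.Ioi_subset_Ioi hxy)) fun x => measureReal_nonneg
  have hny : Tendsto (fun n : ℕ => (n : ℝ) * y) atTop atTop :=
    tendsto_natCast_atTop_atTop.atTop_mul_const hy
  have h1 : Tendsto (fun n : ℕ => (∫ v, expRemainder (u * (v / (n * y))) ∂P) / f (n * y)) atTop
      (𝓝 (-Real.Gamma (1 - ν) * u ^ ν)) := by
    -- The factor `u` is absorbed into the scale `ny/u`; regular variation returns it as `u^ν`.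
    have hz : Tendsto (fun n : ℕ => (n : ℝ) * y / u) atTop atTop := hny.atTop_div_const hu
    have h2 := (tendsto_integral_expRemainder hν₁ hν₂ hP hF).comp hz
    have h3 := ((hF u hu).inv₀ (by positivity)).comp hz
    rw [Real.rpow_neg hu.le, inv_inv] at h3
    refine (h2.mul h3).congr' ?_
    filter_upwards [hny.eventually_gt_atTop 0] with n hn
    have e1 : u * (n * y / u) = n * y := by field_simp
    have e2 : ∀ v, v / (n * y / u) = u * (v / (n * y)) := fun v => by field_simp
    simp only [Function.comp_apply, e1, e2]
    rw [inv_div]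
    exact div_mul_div_cancel₀ (hpos _).ne'
  have h2 : Tendsto (fun n : ℕ => (u / (rate n * (n * y)) * (1 - rate n * ∫ v, v ∂P)) / f (n * y))
      atTop (𝓝 (u / lam * (γ * y ^ (ν - 1)))) := by
    have h3 := ((hF y hy).inv₀ (by positivity)).comp (tendsto_natCast_atTop_atTop (R := ℝ))
    rw [Real.rpow_neg hy.le, inv_inv] at h3
    have h4 : Tendsto (fun n => u / (rate n * y)) atTop (𝓝 (u / (lam * y))) :=
      (tendsto_const_nhds (x := u)).div (hrate.mul_const y) (by positivity)
    have h5 := h4.mul (hheavy.mul h3)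
    have e1 : u / (lam * y) * (γ * y ^ ν) = u / lam * (γ * y ^ (ν - 1)) := by
      rw [Real.rpow_sub_one hy.ne']
      field_simp
    rw [e1] at h5
    refine h5.congr' ?_
    filter_upwards [eventually_gt_atTop 0] with n hn
    have hn' : (0 : ℝ) < n := by exact_mod_cast hn
    have := hpos n
    have := hpos (n * y)
    simp only [Function.comp_apply, mul_comm y]
    change u / (rate n * y) * ((1 - rate n * ∫ v, v ∂P) / (n * f n) * (f (n * y) / f n)⁻¹) = _
    field_simp
  have h3 := (tendsto_setIntegral_exp_Ioi (by linarith) hF hu).comp hny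
  have h4 := (h1.add h2).sub h3
  have e1 : kappaGap ν lam (γ * y ^ (ν - 1)) (u / lam) =
      -Real.Gamma (1 - ν) * u ^ ν + u / lam * (γ * y ^ (ν - 1)) -
        ∫ t, Real.exp (-(u * t)) ∂(paretoMeasure 1 ν) := by
    rw [kappaGap, mul_div_cancel₀ _ hlam.ne', paretoLaplace]
  rw [e1]
  refine h4.congr fun n => ?_
  simp only [Function.comp_apply, fixedPointGap, hf]
  ring

lemma tendsto_measureReal_Ioi [IsProbabilityMeasure P] :
    Tendsto (fun x => P.real (Set.Ioi x)) atTop (𝓝 0) := by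
  have h1 := (tendsto_cdf_atTop P).const_sub 1
  rw [sub_self] at h1
  refine h1.congr fun x => ?_
  rw [cdf_eq_real, ← Set.compl_Iic, probReal_compl_eq_one_sub measurableSet_Iic]

/-- Roots of the fixed-point equations converge to the root of the limiting equation. -/
lemma tendsto_fixedPoint [IsProbabilityMeasure P] (hν₁ : 1 < ν) (hν₂ : ν < 2)
    (hP : ∀ᵐ v ∂P, 0 ≤ v) (hint : Integrable (fun v => v) P)
    (hF : RegularlyVarying (fun x => P.real (Set.Ioi x)) (-ν))
    {rate : ℕ → ℝ} (hrate_pos : ∀ n, 0 < rate n) (hload : ∀ n, rate n * ∫ v, v ∂P ≤ 1)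
    (hlam : 0 < lam) (hrate : Tendsto rate atTop (𝓝 lam)) (hγ : 0 ≤ γ)
    (hheavy : Tendsto (fun n : ℕ => (1 - rate n * ∫ v, v ∂P) / (n * P.real (Set.Ioi (n : ℝ))))
      atTop (𝓝 γ)) {y κ : ℝ} (hy : 0 < y) (hκ : 0 < κ)
    (hroot : kappaGap ν lam (γ * y ^ (ν - 1)) κ = 0) {w : ℕ → ℝ} (hw0 : ∀ᶠ n in atTop, 0 < w n)
    (hw : ∀ᶠ n : ℕ in atTop, fixedPointGap P (rate n) (n * y) (w n) = 0) :
    Tendsto w atTop (𝓝 (lam * κ)) := by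
  have hpos := hF.pos_of_antitone
    (fun x y hxy => measureReal_mono (Set.Ioi_subset_Ioi hxy)) fun x => measureReal_nonneg
  have hb : 0 ≤ γ * y ^ (ν - 1) := by positivity
  have hny : ∀ᶠ n : ℕ in atTop, 0 < (n : ℝ) * y :=
    (tendsto_natCast_atTop_atTop.atTop_mul_const hy).eventually_gt_atTop 0
  -- For `0 < a < lam * κ` the limiting gap at `a` is negative, whereas `w n ≤ a` would make the gap
  -- at `a` nonnegative by monotonicity. The other side is symmetric.
  refine tendsto_order.2 ⟨fun a ha => ?_, fun a ha => ?_⟩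
  · rcases le_or_gt a 0 with h0 | h0
    · filter_upwards [hw0] with n hn using h0.trans_lt hn
    · have h1 : kappaGap ν lam (γ * y ^ (ν - 1)) (a / lam) < 0 := by
        rw [← hroot]
        refine kappaGap_strictMono hν₁ hν₂ hlam hb (by positivity) ?_
        rw [div_lt_iff₀ hlam]
        linarith
      filter_upwards [(tendsto_fixedPointGap hν₁ hν₂ hP hF hlam hrate hheavy hy
        h0).eventually_lt_const h1, hw0, hw, hny] with n hn hn0 hwn hnyn
      by_contra! hle
      have h2 := fixedPointGap_mono hP hint (hload n) (hrate_pos n) hnyn hn0.le hle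
      rw [hwn] at h2
      exact absurd hn (not_lt.2 (div_nonneg h2 (hpos _).le))
  · have h0 : 0 < a := lt_trans (by positivity) ha
    have h1 : 0 < kappaGap ν lam (γ * y ^ (ν - 1)) (a / lam) := by
      rw [← hroot]
      refine kappaGap_strictMono hν₁ hν₂ hlam hb hκ.le ?_
      rw [lt_div_iff₀ hlam]
      linarith
    filter_upwards [(tendsto_fixedPointGap hν₁ hν₂ hP hF hlam hrate hheavy hy
      h0).eventually_const_lt h1, hw, hny] with n hn hwn hnyn
    by_contra! hle
    have h2 := fixedPointGap_mono hP hint (hload n) (hrate_pos n) hnyn h0.le hle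
    rw [hwn] at h2
    exact absurd hn (not_lt.2 (div_nonpos_of_nonpos_of_nonneg h2 (hpos _).le))

lemma tail_eq_map {Ω : Type*} [MeasurableSpace Ω] {μ : Measure Ω} [IsProbabilityMeasure μ]
    {X : Ω → ℝ} (hX : Measurable X) :
    tail μ X = fun x => (μ.map X).real (Set.Ioi x) := by
  funext x
  have h : {ω | X ω ≤ x} = (X ⁻¹' Set.Ioi x)ᶜ := by
    ext ω
    simp
  rw [tail, distFun, map_measureReal_apply hX measurableSet_Ioi, h,
    probReal_compl_eq_one_sub (hX measurableSet_Ioi), sub_sub_cancel]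

end Convergence

end TandemQueue

end

/-! ### Heavy-traffic limit of the largest job -/

theorem theorem2p1
    {Ω : Type*} [MeasurableSpace Ω] (μ : Measure Ω) [IsProbabilityMeasure μ]
    (ν γ : ℝ) (hν₁ : 1 < ν) (hν₂ : ν < 2) (hγ : 0 ≤ γ)
    -- i.i.d. service times, common to all the models
    (V : ℕ → Ω → ℝ)
    (hV_meas : ∀ i, Measurable (V i))
    (hV_nonneg : ∀ i, ∀ᵐ ω ∂μ, 0 ≤ V i ω)
    (hV_indep : iIndepFun V μ)
    (hV_ident : ∀ i, IdentDistrib (V i) (V 0) μ μ)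
    (hV_mean : 0 < ∫ ω, V 0 ω ∂μ)
    (hV_tail : TandemQueue.RegularlyVarying (TandemQueue.tail μ (V 0)) (-ν))
    -- in the `n`-th model: Poisson arrivals of rate `rate n`, given by their i.i.d. exponential
    -- inter-arrival times, independent of the service times
    (rate : ℕ → ℝ) (hrate_pos : ∀ n, 0 < rate n)
    (τ : ℕ → ℕ → Ω → ℝ)
    (hτ_meas : ∀ n i, Measurable (τ n i))
    (hτ_indep : ∀ n, iIndepFun (τ n) μ)
    (hτ_law : ∀ n i, μ.map (τ n i) = expMeasure (rate n))
    (hVτ_indep : ∀ n, IndepFun (fun ω i => V i ω) (fun ω i => τ n i ω) μ)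
    -- heavy traffic
    (lam : ℝ) (hlam : lam = 1 / ∫ ω, V 0 ω ∂μ)
    (hrate_mono : Monotone rate)
    (hrate_lim : Tendsto rate atTop (𝓝 lam))
    (hheavy : Tendsto
      (fun n : ℕ => (1 - rate n * ∫ ω, V 0 ω ∂μ) / ((n : ℝ) * TandemQueue.tail μ (V 0) (n : ℝ)))
      atTop (𝓝 γ)) :
    ∃ κ : ℝ → ℝ,
      -- `κ y` is the unique positive solution of the equation
      (∀ y : ℝ, 0 < y →
        0 < κ y ∧ TandemQueue.KappaEquation ν lam γ y (κ y) ∧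
          ∀ k : ℝ, 0 < k → TandemQueue.KappaEquation ν lam γ y k → k = κ y) ∧
      -- limit of the rescaled tail of the largest job in the `k`-th busy period
      (∀ k : ℕ, ∀ y : ℝ, 0 < y →
        Tendsto
          (fun n : ℕ => (n : ℝ) * TandemQueue.tail μ
            (fun ω => TandemQueue.largestJob (fun i => V i ω) (fun i => τ n i ω) k) ((n : ℝ) * y))
          atTop (𝓝 (κ y / y))) ∧
      (γ = 0 → ∃ c : ℝ, ∀ y : ℝ, 0 < y → κ y = c) ∧
      (0 < γ → TandemQueue.RegularlyVarying κ (1 - ν)) ∧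
      ContinuousOn κ (Set.Ioi 0) ∧
      (∀ y : ℝ, 0 < y → κ y ≤ 1 / lam * (-1 / Real.Gamma (1 - ν)) ^ (1 / ν)) := by
  set P := μ.map (V 0) with hP_def
  have hPprob : IsProbabilityMeasure P := Measure.isProbabilityMeasure_map (hV_meas 0).aemeasurable
  have hmean : ∫ ω, V 0 ω ∂μ = ∫ v, v ∂P :=
    (integral_map (hV_meas 0).aemeasurable aestronglyMeasurable_id).symm
  have htail : TandemQueue.tail μ (V 0) = fun x => P.real (Set.Ioi x) :=
    TandemQueue.tail_eq_map (hV_meas 0)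
  rw [htail] at hV_tail hheavy
  rw [hmean] at hV_mean hlam
  simp only [hmean] at hheavy
  -- The Bochner integral of a nonintegrable function is 0, so a positive mean entails
  -- integrability.
  have hint : Integrable (fun v => v) P := by
    by_contra h
    rw [integral_undef h] at hV_mean
    exact lt_irrefl _ hV_mean
  have hlam0 : 0 < lam := by
    rw [hlam]
    positivity
  -- A nondecreasing sequence stays below its limit `lam`, the critical rate.
  have hload : ∀ n, rate n * ∫ v, v ∂P ≤ 1 := by
    intro n
    have h := hrate_mono.ge_of_tendsto hrate_lim n
    rwa [hlam, le_div_iff₀ hV_mean] at h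
  have hQ : ∀ n, TandemQueue.IsPoissonQueue μ V (τ n) P (rate n) := fun n =>
    TandemQueue.isPoissonQueue_of_indep (hrate_pos n) hV_meas hV_nonneg hV_indep hV_ident
      (hτ_meas n) (hτ_indep n) (hτ_law n) (hVτ_indep n)
  have hP : ∀ᵐ v ∂P, 0 ≤ v := (hQ 0).service_nonneg
  have hFpos := hV_tail.pos_of_antitone
    (fun x y hxy => measureReal_mono (Set.Ioi_subset_Ioi hxy)) fun x => measureReal_nonneg
  have hexists : ∀ y : ℝ, ∃ κ : ℝ, 0 < y → 0 < κ ∧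
      TandemQueue.kappaGap ν lam (γ * y ^ (ν - 1)) κ = 0 ∧
        κ ≤ 1 / lam * (-1 / Real.Gamma (1 - ν)) ^ (1 / ν) := by
    intro y
    by_cases hy : 0 < y
    · obtain ⟨κ, hκ⟩ := TandemQueue.exists_kappaGap_eq_zero hν₁ hν₂ hlam0
        (show 0 ≤ γ * y ^ (ν - 1) by positivity)
      exact ⟨κ, fun _ => hκ⟩
    · exact ⟨0, fun h => absurd h hy⟩
  choose κ hκ using hexists
  have huniq : ∀ y : ℝ, 0 < y → ∀ k : ℝ, 0 < k →
      TandemQueue.KappaEquation ν lam γ y k → k = κ y := by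
    intro y hy k hk hkeq
    obtain ⟨h1, h2, -⟩ := hκ y hy
    rw [TandemQueue.kappaEquation_iff hν₁ hν₂] at hkeq
    have hb : 0 ≤ γ * y ^ (ν - 1) := by positivity
    rcases lt_trichotomy k (κ y) with h | h | h
    · have := TandemQueue.kappaGap_strictMono hν₁ hν₂ hlam0 hb hk.le h
      linarith
    · exact h
    · have := TandemQueue.kappaGap_strictMono hν₁ hν₂ hlam0 hb h1.le h
      linarith
  have heq : ∀ y : ℝ, 0 < y → TandemQueue.KappaEquation ν lam γ y (κ y) := fun y hy =>
    (TandemQueue.kappaEquation_iff hν₁ hν₂ y (κ y)).2 (hκ y hy).2.1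
  refine ⟨κ, fun y hy => ⟨(hκ y hy).1, heq y hy, huniq y hy⟩, ?_, ?_, ?_, ?_,
    fun y hy => (hκ y hy).2.2⟩
  · intro k y hy
    have hny : Tendsto (fun n : ℕ => (n : ℝ) * y) atTop atTop :=
      tendsto_natCast_atTop_atTop.atTop_mul_const hy
    have hgood : ∀ᶠ n : ℕ in atTop, 0 < (n : ℝ) * y ∧ P.real (Set.Ioi ((n : ℝ) * y)) < 1 :=
      (hny.eventually_gt_atTop 0).and
        ((TandemQueue.tendsto_measureReal_Ioi.comp hny).eventually_lt_const one_pos)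
    have hq_exists : ∀ n : ℕ, ∃ q : ℝ, (0 < (n : ℝ) * y ∧ P.real (Set.Ioi ((n : ℝ) * y)) < 1) →
        0 < q ∧ q < 1 ∧
        TandemQueue.laplaceOn P (Set.Iic ((n : ℝ) * y)) (rate n * (1 - q)) = ENNReal.ofReal q ∧
          TandemQueue.fixedPointGap P (rate n) (n * y) (rate n * (1 - q) * (n * y)) = 0 := by
      intro n
      by_cases h : 0 < (n : ℝ) * y ∧ P.real (Set.Ioi ((n : ℝ) * y)) < 1
      · obtain ⟨q, hq⟩ := TandemQueue.exists_fixedPoint hP hint (hrate_pos n) h.1 (hFpos _) h.2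
        exact ⟨q, fun _ => hq⟩
      · exact ⟨0, fun h' => absurd h' h⟩
    choose q hq using hq_exists
    have hlim := TandemQueue.tendsto_fixedPoint hν₁ hν₂ hP hint hV_tail hrate_pos hload hlam0
      hrate_lim hγ hheavy hy (hκ y hy).1 (hκ y hy).2.1
      (w := fun n => rate n * (1 - q n) * (n * y))
      (by
        filter_upwards [hgood] with n hn
        exact mul_pos (mul_pos (hrate_pos n) (sub_pos.2 (hq n hn).2.1)) hn.1)
      (by
        filter_upwards [hgood] with n hn
        exact (hq n hn).2.2.2)
    -- Dividing `rate n * (1 - q n) * (n * y)` by `rate n * y` leaves `n * (1 - q n)`.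
    have hlim' := hlim.div (hrate_lim.mul_const y) (by positivity)
    rw [mul_div_mul_left _ _ hlam0.ne'] at hlim'
    refine hlim'.congr' ?_
    filter_upwards [hgood] with n hn
    obtain ⟨hq0, hq1, hqL, -⟩ := hq n hn
    rw [TandemQueue.tail, TandemQueue.distFun,
      (hQ n).measure_largestJob_le hint (hload n) k hq0 hq1 hqL]
    have := (hrate_pos n).ne'
    simp only [Pi.div_apply]
    field_simp
  · intro hγ0
    -- For `γ = 0` the equation no longer involves `y`, so uniqueness at `y = 1` applies.
    refine ⟨κ 1, fun y hy => huniq 1 one_pos (κ y) (hκ y hy).1 ?_⟩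
    have h := heq y hy
    rw [TandemQueue.KappaEquation, hγ0] at h ⊢
    simpa using h
  · exact fun hγ0 => TandemQueue.regularlyVarying_of_kappaGap hν₁ hν₂ hlam0 hγ0
      (fun y hy => (hκ y hy).1) fun y hy => (hκ y hy).2.1
  · exact TandemQueue.continuousOn_of_kappaGap hν₁ hν₂ hlam0 hγ
      (fun y hy => (hκ y hy).1) fun y hy => (hκ y hy).2.1
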